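/- Let $X=(X_t)_{t\ge 0}$ be a spectrally negative Lévy process under $\mathsf P$, i.e. a càdlàg real-valued process with stationary independent increments, $X_0=0$ a.s., no positive jumps and non-monotone paths. Let $\psi(c)=\log \mathsf E[e^{cX_1}]$ for $c\ge 0$, let $\Phi(p)=\inf\{c\ge 0:\psi(c)>p\}$ for $p\ge 0$, fix $q\in[0,\infty)$, and let $W^{(q)}:\mathbb R\to[0,\infty)$ be the $q$-scale function of $X$, i.e. the function that vanishes on $(-\infty,0)$, is continuous on $[0,\infty)$ and satisfies $\int_0^\infty e^{-\theta x}W^{(q)}(x)\,dx=\frac1{\psi(\theta)-q}$ for all $\theta>\Phi(q)$. Let $\omega:\mathbb R\to[0,\infty)$ be Borel measurable and locally bounded. For Borel $f,h:\mathbb R\to\mathbb R$ write $(f\star h)(x)=\int_{-\infty}^\infty f(y)h(x-y)\,dy$. For $\alpha\ge0$, say that $f$ has an $\alpha$-subexponential left tail if there are $x_0\in\mathbb R$ and $\gamma<\infty$ with $|f(x)|\le\gamma e^{\alpha x}$ for all $x\le x_0$, and that $f$ has a subexponential left tail if this holds for some $\alpha>0$. Suppose that $(\omega e^{\Phi(q)\cdot})\star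 W^{(q)}$ is finite-valued (this is the case if $\omega$ has a subexponential left tail). Let $G:\mathbb R\to\mathbb R$ be Borel measurable and locally bounded with a $\Phi(q)$-subexponential left tail. Then: (i) $(\omega G)\star W^{(q)}$ is well-defined and finite everywhere, and $\lim_{x\to-\infty}e^{-\Phi(q)x}\big((\omega G)\star W^{(q)}\big)(x)=0$. (ii) If $G=(G\omega)\star W^{(q)}$, then $G=0$. (iii) Let in addition $g:\mathbb R\to[0,\infty)$ be Borel measurable and locally bounded with a $\Phi(q)$-subexponential left tail, and suppose that $G\ge0$ and $G=g+(\omega G)\star W^{(q)}$. Define $G_0:=g$ and $G_{n+1}:=g+(\omega G_n)\star W^{(q)}$ for $n\ge0$. Then all these convolutions are finite-valued, $G_n(x)$ is nondecreasing in $n$, and $G_n(x)\to G(x)$ as $n\to\infty$, for every $x\in\mathbb R$. -/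

import Mathlib

open MeasureTheory ProbabilityTheory Filter Topology
open scoped NNReal

/-! ### Spectrally negative Lévy processes -/

/-- A path is càdlàg: right-continuous with finite left limits. -/
def IsCadlagPath (f : ℝ≥0 → ℝ) : Prop :=
  (∀ t, ContinuousWithinAt f (Set.Ici t) t) ∧
    ∀ t, 0 < t → ∃ l : ℝ, Tendsto f (𝓝[<] t) (𝓝 l)

/-- A path has no positive jumps: `f t ≤ f (t-)` for all `t > 0`. -/
def HasNoPositiveJumps (f : ℝ≥0 → ℝ) : Prop :=
  ∀ t, 0 < t → ∀ l : ℝ, Tendsto f (𝓝[<] t) (𝓝 l) → f t ≤ l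

/-- `X` is, under `P`, a spectrally negative Lévy process: a real-valued càdlàg process with
stationary independent increments, started at zero, having no positive jumps and non-monotone
paths. -/
structure IsSpectrallyNegativeLevy {Ω : Type*} [MeasurableSpace Ω] (X : ℝ≥0 → Ω → ℝ)
    (P : Measure Ω) : Prop where
  measurable : ∀ t, Measurable (X t)
  start_zero : ∀ᵐ w ∂P, X 0 w = 0
  indep_increments : HasIndepIncrements X P
  stationary_increments : ∀ s t,
    IdentDistrib (fun w => X (s + t) w - X s w) (fun w => X t w - X 0 w) P P
  cadlag : ∀ᵐ w ∂P, IsCadlagPath (fun t => X t w)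
  no_positive_jumps : ∀ᵐ w ∂P, HasNoPositiveJumps (fun t => X t w)
  non_monotone : ∀ᵐ w ∂P, ¬ Monotone (fun t => X t w) ∧ ¬ Antitone (fun t => X t w)

/-- The Laplace exponent `ψ(c) = log E[exp (c X₁)]`. -/
noncomputable def laplaceExponent {Ω : Type*} [MeasurableSpace Ω] (X : ℝ≥0 → Ω → ℝ)
    (P : Measure Ω) (c : ℝ) : ℝ :=
  Real.log (∫ w, Real.exp (c * X 1 w) ∂P)

/-- The right-continuous inverse `Φ(p) = inf {c ≥ 0 : ψ(c) > p}` of a Laplace exponent `ψ`. -/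
noncomputable def exponentInverse (ψ : ℝ → ℝ) (p : ℝ) : ℝ :=
  sInf {c : ℝ | 0 ≤ c ∧ p < ψ c}

/-- `W` is the `q`-scale function of the process with Laplace exponent `ψ`: it is nonnegative,
vanishes on `(-∞, 0)`, is continuous on `[0, ∞)`, and has Laplace transform `1 / (ψ(θ) - q)`
for `θ > Φ(q)`. -/
structure IsScaleFunction (ψ : ℝ → ℝ) (q : ℝ) (W : ℝ → ℝ) : Prop where
  nonneg : ∀ x, 0 ≤ W x
  zero_of_neg : ∀ x, x < 0 → W x = 0
  continuousOn : ContinuousOn W (Set.Ici 0)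
  integrableOn : ∀ θ, exponentInverse ψ q < θ →
    IntegrableOn (fun x => Real.exp (-θ * x) * W x) (Set.Ici 0)
  laplace : ∀ θ, exponentInverse ψ q < θ →
    ∫ x in Set.Ici 0, Real.exp (-θ * x) * W x = 1 / (ψ θ - q)

/-! ### Convolution on the real line -/

/-- The convolution `(f ⋆ g)(x) = ∫ f(y) g(x - y) dy` on the real line. -/
noncomputable def realConv (f g : ℝ → ℝ) : ℝ → ℝ :=
  convolution f g (ContinuousLinearMap.mul ℝ ℝ) volume

/-- `f ⋆ g` is well-defined and finite at every point: the integrand `y ↦ f(y) g(x - y)` is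
Lebesgue integrable for every `x`. -/
def RealConvFinite (f g : ℝ → ℝ) : Prop :=
  ConvolutionExists f g (ContinuousLinearMap.mul ℝ ℝ) volume

/-- The Picard iterates `G₀ = g`, `Gₙ₊₁ = g + (ω Gₙ) ⋆ W`. -/
noncomputable def picardIterate (ω W g : ℝ → ℝ) : ℕ → ℝ → ℝ
  | 0 => g
  | n + 1 => fun x => g x + realConv (fun y => ω y * picardIterate ω W g n y) W x

/-! ### Growth conditions -/

/-- `f` is bounded on every compact interval. -/
def IsLocallyBddFun (f : ℝ → ℝ) : Prop :=
  ∀ a b : ℝ, ∃ C : ℝ, ∀ x ∈ Set.Icc a b, |f x| ≤ C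

/-- `f` has a left tail that is `α`-subexponential. -/
def HasSubexpLeftTailOf (α : ℝ) (f : ℝ → ℝ) : Prop :=
  ∃ x₀ γ : ℝ, ∀ x ≤ x₀, |f x| ≤ γ * Real.exp (α * x)

/-- `f` has a subexponential left tail. -/
def HasSubexpLeftTail (f : ℝ → ℝ) : Prop :=
  ∃ α : ℝ, 0 < α ∧ HasSubexpLeftTailOf α f

/-! ### Increments of a càdlàg process without positive jumps -/

/-! Everything rests on one property of the scale function: with Φ = Φ(q), the tilt V(x) = e^{-Φx}
W(x) is nondecreasing (`IsScaleFunction.monotone_tilt`). For y ≤ x ≤ A it allows V(x - y) to be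
replaced by V(A - y), so the tilted convolution e^{-Φx} |(ωG) ⋆ W|(x) is at most the integral over
(-∞, x] of e^{-Φy} |G(y)| k(y), where k(y) = ω(y) V(A - y) does not depend on x
(`exp_mul_abs_realConv_le`). Finiteness of (ω e^{Φ·}) ⋆ W says that k is integrable for every A.
Since e^{-Φy} |G(y)| is bounded on left half-lines, (i) follows from the vanishing mass of k near
-∞. In (ii), H = e^{-Φ·} |G| satisfies a linear Volterra inequality, and a Gronwall argument started
at -∞ gives H = 0 (`eq_zero_of_le_integral_Iic`). In (iii), the iterates increase to some L ≤ G
solving the same equation, and (ii) applies to G - L.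

Monotonicity of V is obtained from Laplace transforms. Outside a degenerate case where W = 0, ψ(Φ) =
q and V has transform 1/(ψ(Φ+θ) - ψ(Φ)). If Z is the increment of X over time 1/(n+1), then (n+1)(E
e^{cZ} - 1) → ψ(c). Expanding the positive part of Z to second order gives ψ(Φ+θ) - ψ(Φ) = lim (dθ +
σθ² - j(θ)), where d, σ ≥ 0 and j depend on n and j comes from the negative part of Z; the cubic
remainder vanishes because the absence of positive jumps forces (n+1) P(Z > ε) → 0. Writing dθ + σθ²
- j = θ (d + σθ) (1 - (j/θ)/(d + σθ)) exhibits the reciprocal as the transform of a positive measure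
convolved with Lebesgue measure on (0, ∞). Such a convolution has a nondecreasing density, and this
survives the limit by the method of moments in the variable e^{-x}
(`monotone_of_tendsto_lapTransform`). -/

lemma IsCadlagPath.exists_leftLim {f : ℝ≥0 → ℝ} (hf : IsCadlagPath f)
    (hJ : HasNoPositiveJumps f) (t : ℝ≥0) :
    ∃ l : ℝ, f t ≤ l ∧ Tendsto f (𝓝[<] t) (𝓝 l) := by
  rcases eq_or_ne t 0 with rfl | ht
  -- The left neighbourhood filter of 0 in `ℝ≥0` is trivial, so any limit will do.
  · exact ⟨f 0, le_rfl, by simp⟩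
  · obtain ⟨l, hl⟩ := hf.2 t (pos_iff_ne_zero.2 ht)
    exact ⟨l, hJ t (pos_iff_ne_zero.2 ht) l hl, hl⟩

/-- Left of t the path is near its left limit l, right of t near f t. An increment that stays on one
side is small, and one that crosses t from left to right is close to f t - l ≤ 0. -/
lemma IsCadlagPath.exists_nhds_sub_le {f : ℝ≥0 → ℝ} (hf : IsCadlagPath f)
    (hJ : HasNoPositiveJumps f) {ε : ℝ} (hε : 0 < ε) (t : ℝ≥0) :
    ∃ U ∈ 𝓝 t, ∀ s ∈ U, ∀ s' ∈ U, s ≤ s' → f s' - f s ≤ ε := by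
  obtain ⟨l, hle, hl⟩ := hf.exists_leftLim hJ t
  have h1 : ∀ᶠ s in 𝓝[<] t, |f s - l| < ε / 2 := by
    have := (Metric.tendsto_nhds.1 hl) (ε / 2) (by positivity)
    simpa [Real.dist_eq] using this
  have h2 : ∀ᶠ s in 𝓝[≥] t, |f s - f t| < ε / 2 := by
    have := (Metric.tendsto_nhds.1 (hf.1 t)) (ε / 2) (by positivity)
    simpa [Real.dist_eq] using this
  rw [eventually_nhdsWithin_iff] at h1 h2
  refine ⟨_, h1.and h2, ?_⟩
  rintro s ⟨hs1, hs2⟩ s' ⟨hs1', hs2'⟩ hss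
  rcases lt_or_ge s t with h | h <;> rcases lt_or_ge s' t with h' | h'
  · have a := abs_lt.1 (hs1 h); have b := abs_lt.1 (hs1' h'); linarith [a.1, b.2]
  · have a := abs_lt.1 (hs1 h); have b := abs_lt.1 (hs2' h'); linarith [a.1, b.2]
  · exact absurd (h.trans hss) (not_le.2 h')
  · have a := abs_lt.1 (hs2 h); have b := abs_lt.1 (hs2' h'); linarith [a.1, b.2]

lemma IsCadlagPath.exists_uniform_sub_le {f : ℝ≥0 → ℝ} (hf : IsCadlagPath f)
    (hJ : HasNoPositiveJumps f) {ε : ℝ} (hε : 0 < ε) :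
    ∃ δ > 0, ∀ s s' : ℝ≥0, s ≤ s' → s ≤ 1 → dist s' s < δ → f s' - f s ≤ ε := by
  choose U hU hUf using hf.exists_nhds_sub_le hJ hε
  obtain ⟨δ, hδ, h⟩ := lebesgue_number_lemma_of_metric (s := Set.Icc (0 : ℝ≥0) 1)
    (c := fun t => interior (U t)) isCompact_Icc (fun t => isOpen_interior)
    (fun t _ => Set.mem_iUnion.2 ⟨t, mem_interior_iff_mem_nhds.2 (hU t)⟩)
  refine ⟨δ, hδ, fun s s' hss hs hd => ?_⟩
  obtain ⟨t, ht⟩ := h s ⟨zero_le, hs⟩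
  exact hUf t s (interior_subset (ht (Metric.mem_ball_self hδ))) s'
    (interior_subset (ht (Metric.mem_ball.2 hd))) hss

/-- The increment of the process over `[0, 1 / (n + 1)]`. -/
noncomputable def gridIncrement {Ω : Type*} (X : ℝ≥0 → Ω → ℝ) (n : ℕ) (w : Ω) : ℝ :=
  X (1 / (n + 1)) w - X 0 w

section

variable {Ω : Type*} [MeasurableSpace Ω] {P : Measure Ω} {X : ℝ≥0 → Ω → ℝ}

lemma IsSpectrallyNegativeLevy.measurable_gridIncrement (hX : IsSpectrallyNegativeLevy X P)
    (n : ℕ) : Measurable (gridIncrement X n) :=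
  (hX.measurable _).sub (hX.measurable _)

lemma IsSpectrallyNegativeLevy.iIndepFun_grid (hX : IsSpectrallyNegativeLevy X P) (n : ℕ) :
    iIndepFun (fun (k : ℕ) w => X (((k + 1 : ℕ) : ℝ≥0) / (n + 1)) w - X ((k : ℝ≥0) / (n + 1)) w)
      P := by
  have hm : Monotone (fun k : ℕ => (k : ℝ≥0) / (n + 1)) := fun a b hab => by
    dsimp only; gcongr
  exact hX.indep_increments.nat hm

lemma IsSpectrallyNegativeLevy.identDistrib_grid (hX : IsSpectrallyNegativeLevy X P) (n k : ℕ) :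
    IdentDistrib (fun w => X (((k + 1 : ℕ) : ℝ≥0) / (n + 1)) w - X ((k : ℝ≥0) / (n + 1)) w)
      (gridIncrement X n) P P := by
  have := hX.stationary_increments ((k : ℝ≥0) / (n + 1)) (1 / (n + 1))
  rwa [← add_div, ← Nat.cast_succ] at this

lemma IsSpectrallyNegativeLevy.mgf_gridIncrement_pow [IsProbabilityMeasure P]
    (hX : IsSpectrallyNegativeLevy X P) (n : ℕ) (c : ℝ) :
    mgf (gridIncrement X n) P c ^ (n + 1) = mgf (X 1) P c := by
  have h := (hX.iIndepFun_grid n).mgf_sum (t := c)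
    (fun k => (hX.measurable _).sub (hX.measurable _)) (Finset.range (n + 1))
  have h2 : ∀ k ∈ Finset.range (n + 1), mgf (fun w => X (((k + 1 : ℕ) : ℝ≥0) / (n + 1)) w -
      X ((k : ℝ≥0) / (n + 1)) w) P c = mgf (gridIncrement X n) P c :=
    fun k _ => congrFun (mgf_congr_identDistrib (hX.identDistrib_grid n k)) c
  rw [Finset.prod_congr rfl h2, Finset.prod_const, Finset.card_range] at h
  rw [← h]
  apply mgf_congr
  filter_upwards [hX.start_zero] with w hw
  rw [Finset.sum_apply, Finset.sum_range_sub (fun k : ℕ => X ((k : ℝ≥0) / (n + 1)) w)]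
  simp [hw]

lemma IsSpectrallyNegativeLevy.tendsto_measure_grid [IsProbabilityMeasure P]
    (hX : IsSpectrallyNegativeLevy X P) {ε : ℝ} (hε : 0 < ε) :
    Tendsto (fun n : ℕ => P.real (⋂ k ∈ Finset.range (n + 1),
      (fun w => X (((k + 1 : ℕ) : ℝ≥0) / (n + 1)) w - X ((k : ℝ≥0) / (n + 1)) w) ⁻¹'
        Set.Iic ε)) atTop (𝓝 1) := by
  have hmeas : ∀ n : ℕ, MeasurableSet (⋂ k ∈ Finset.range (n + 1),
      (fun w => X (((k + 1 : ℕ) : ℝ≥0) / (n + 1)) w - X ((k : ℝ≥0) / (n + 1)) w) ⁻¹'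
        Set.Iic ε) := fun n => Finset.measurableSet_biInter _ fun k _ =>
    ((hX.measurable _).sub (hX.measurable _)) measurableSet_Iic
  have h := tendsto_measure_of_ae_tendsto_indicator_of_isFiniteMeasure (μ := P) atTop
    (A := Set.univ) MeasurableSet.univ hmeas ?_
  · have h' := (ENNReal.tendsto_toReal (by simp)).comp h
    simpa [Measure.real, Function.comp_def] using h'
  -- On almost every path all grid increments are at most ε once the mesh is below the uniform δ, so
  -- the indicators of the events are eventually 1.
  · filter_upwards [hX.cadlag, hX.no_positive_jumps] with w h1 h2
    obtain ⟨δ, hδ, hd⟩ := IsCadlagPath.exists_uniform_sub_le h1 h2 hε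
    obtain ⟨N, hN⟩ := exists_nat_one_div_lt hδ
    filter_upwards [eventually_ge_atTop N] with n hn
    simp only [Set.mem_iInter, Set.mem_univ, iff_true]
    intro k hk
    rw [Finset.mem_range] at hk
    refine hd _ _ (by gcongr; simp) ?_ ?_
    · rw [div_le_one (by positivity)]
      exact_mod_cast hk.le
    · have hn' : (N : ℝ) ≤ n := by exact_mod_cast hn
      have : (1 : ℝ) / (n + 1) ≤ 1 / (N + 1) := by gcongr
      rw [NNReal.dist_eq]
      push_cast
      rw [← sub_div, add_sub_cancel_left, abs_of_pos (by positivity)]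
      linarith

/-- Since log(1 - p) ≤ -p, the quantity (n+1) p is at most -log((1 - p)^(n+1)), which tends to -log
1 = 0. -/
lemma tendsto_mul_of_tendsto_one_sub_pow {p : ℕ → ℝ} (h0 : ∀ n, 0 ≤ p n) (h1 : ∀ n, p n ≤ 1)
    (h : Tendsto (fun n : ℕ => (1 - p n) ^ (n + 1)) atTop (𝓝 1)) :
    Tendsto (fun n : ℕ => ((n : ℝ) + 1) * p n) atTop (𝓝 0) := by
  have hlog : Tendsto (fun n : ℕ => - Real.log ((1 - p n) ^ (n + 1))) atTop (𝓝 0) := by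
    have := ((Real.continuousAt_log one_ne_zero).tendsto.comp h).neg
    simpa [Function.comp_def] using this
  refine squeeze_zero' (Eventually.of_forall fun n => mul_nonneg (by positivity) (h0 n)) ?_ hlog
  filter_upwards [h.eventually (lt_mem_nhds (show (0 : ℝ) < 1 by norm_num))] with n hn
  have hp : 0 < 1 - p n := by
    rcases (sub_nonneg.2 (h1 n)).lt_or_eq with h' | h'
    · exact h'
    · rw [← h', zero_pow (by lia)] at hn; exact absurd hn (lt_irrefl _)
  rw [Real.log_pow]
  have := Real.log_le_sub_one_of_pos hp
  push_cast
  nlinarith [show (0 : ℝ) ≤ n by positivity]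

/-- By independence and stationarity, the probability that no grid increment exceeds ε is (1 -
p)^(n+1), where p is the tail probability of a single increment. It tends to 1 by
`tendsto_measure_grid`. -/
lemma IsSpectrallyNegativeLevy.tendsto_measure_gridIncrement [IsProbabilityMeasure P]
    (hX : IsSpectrallyNegativeLevy X P) {ε : ℝ} (hε : 0 < ε) :
    Tendsto (fun n : ℕ => ((n : ℝ) + 1) * P.real {w | ε < gridIncrement X n w}) atTop (𝓝 0) := by
  apply tendsto_mul_of_tendsto_one_sub_pow (fun n => measureReal_nonneg)
    (fun n => measureReal_le_one)
  refine (hX.tendsto_measure_grid hε).congr fun n => ?_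
  have h := (hX.iIndepFun_grid n).measure_inter_preimage_eq_mul (Finset.range (n + 1))
    (sets := fun _ => Set.Iic ε) (fun _ _ => measurableSet_Iic)
  rw [Measure.real, h, ENNReal.toReal_prod]
  have h2 : ∀ k ∈ Finset.range (n + 1), (P ((fun w => X (((k + 1 : ℕ) : ℝ≥0) / (n + 1)) w -
      X ((k : ℝ≥0) / (n + 1)) w) ⁻¹' Set.Iic ε)).toReal =
      1 - P.real {w | ε < gridIncrement X n w} := fun k _ => by
    rw [(hX.identDistrib_grid n k).measure_preimage_eq measurableSet_Iic,
      ← probReal_compl_eq_one_sub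
        (measurableSet_lt measurable_const (hX.measurable_gridIncrement n)), Measure.real]
    congr 2
    ext w
    simp
  rw [Finset.prod_congr rfl h2, Finset.prod_const, Finset.card_range]

end

/-! ### Small-time approximation of the Laplace exponent -/

lemma Real.exp_sub_quadratic_le {x : ℝ} (hx : 0 ≤ x) :
    Real.exp x - 1 - x - x ^ 2 / 2 ≤ x ^ 3 * Real.exp x := by
  rcases le_or_gt x 1 with h | h
  · have := Real.exp_bound (x := x) (by rwa [abs_of_nonneg hx]) (n := 3) (by norm_num)
    rw [abs_of_nonneg hx] at this
    have h2 := (le_abs_self _).trans this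
    simp only [Finset.sum_range_succ, Finset.sum_range_zero, Nat.factorial] at h2
    norm_num at h2
    have h3 : x ^ 3 ≤ x ^ 3 * Real.exp x :=
      le_mul_of_one_le_right (by positivity) (Real.one_le_exp hx)
    have : 0 ≤ x ^ 3 := by positivity
    linarith
  · have : Real.exp x ≤ x ^ 3 * Real.exp x :=
      le_mul_of_one_le_left (Real.exp_nonneg _) (one_le_pow₀ h.le)
    nlinarith

lemma Real.cube_le_six_mul_exp {x : ℝ} (hx : 0 ≤ x) : x ^ 3 ≤ 6 * Real.exp x := by
  have := Real.pow_div_factorial_le_exp x hx 3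
  rw [div_le_iff₀ (by positivity)] at this
  norm_num [Nat.factorial] at this
  linarith

/-- Each term on the right covers one range of z: the first 0 < z ≤ ε, by z ≤ e^z - 1; the indicator
term ε < z ≤ M; the second z > M, where the two extra exponents yield the factor e^{-M}. The weights
e^{cz} (e^z - 1)² are used because their expectations are second differences of the moment
generating function. -/
lemma Real.posPart_cube_mul_exp_le (z : ℝ) {c ε M : ℝ} (hc : 0 ≤ c) (hε : 0 < ε) (hM : 1 ≤ M) :
    max z 0 ^ 3 * Real.exp (c * z) ≤ ε * (Real.exp (c * z) * (Real.exp z - 1) ^ 2) +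
      6 * Real.exp (-M) * (Real.exp ((c + 2) * z) * (Real.exp z - 1) ^ 2) +
      6 * Real.exp ((c + 1) * M) * (Set.Ioi ε).indicator 1 z := by
  have hind : 0 ≤ (Set.Ioi ε).indicator (1 : ℝ → ℝ) z :=
    Set.indicator_nonneg (fun _ _ => zero_le_one) z
  rcases le_or_gt z 0 with hz | hz
  · rw [max_eq_right hz, zero_pow three_ne_zero, zero_mul]
    positivity
  rw [max_eq_left hz.le]
  have hcube : z ^ 3 * Real.exp (c * z) ≤ 6 * Real.exp ((c + 1) * z) := by
    have : Real.exp ((c + 1) * z) = Real.exp z * Real.exp (c * z) := by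
      rw [← Real.exp_add]; ring_nf
    rw [this, ← mul_assoc]
    gcongr
    exact Real.cube_le_six_mul_exp hz.le
  rcases le_or_gt z ε with h1 | h1
  · have : z ^ 3 * Real.exp (c * z) ≤ ε * (Real.exp (c * z) * (Real.exp z - 1) ^ 2) := by
      have h2 : z ≤ Real.exp z - 1 := by linarith [Real.add_one_le_exp z]
      calc z ^ 3 * Real.exp (c * z) = z * (Real.exp (c * z) * z ^ 2) := by ring
        _ ≤ _ := by gcongr
    have : 0 ≤ 6 * Real.exp (-M) * (Real.exp ((c + 2) * z) * (Real.exp z - 1) ^ 2) := by positivity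
    have : 0 ≤ 6 * Real.exp ((c + 1) * M) * (Set.Ioi ε).indicator 1 z := by positivity
    linarith
  have hind1 : (Set.Ioi ε).indicator (1 : ℝ → ℝ) z = 1 := by
    rw [Set.indicator_of_mem (by exact h1)]; rfl
  rw [hind1, mul_one]
  rcases le_or_gt z M with h2 | h2
  · have : Real.exp ((c + 1) * z) ≤ Real.exp ((c + 1) * M) := by gcongr
    have : 0 ≤ ε * (Real.exp (c * z) * (Real.exp z - 1) ^ 2) := by positivity
    have : 0 ≤ 6 * Real.exp (-M) * (Real.exp ((c + 2) * z) * (Real.exp z - 1) ^ 2) := by positivity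
    linarith
  · have h3 : Real.exp ((c + 1) * z) ≤ Real.exp (-M) *
        (Real.exp ((c + 2) * z) * (Real.exp z - 1) ^ 2) := by
      have h4 : 1 ≤ (Real.exp z - 1) ^ 2 := one_le_pow₀ (by linarith [Real.add_one_le_exp z])
      calc Real.exp ((c + 1) * z) ≤ Real.exp (-M + (c + 2) * z) :=
            Real.exp_le_exp.2 (by linarith)
        _ = Real.exp (-M) * (Real.exp ((c + 2) * z) * 1) := by rw [Real.exp_add, mul_one]
        _ ≤ _ := by gcongr
    have : 0 ≤ ε * (Real.exp (c * z) * (Real.exp z - 1) ^ 2) := by positivity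
    have : 0 ≤ 6 * Real.exp ((c + 1) * M) := by positivity
    linarith

/-- `Z n` behaves like the increment over a time step `1 / (n + 1)` of a process with Laplace
exponent `ψ` and without positive jumps. -/
structure IsSmallTimeApprox {Ω : Type*} [MeasurableSpace Ω] (P : Measure Ω) (Z : ℕ → Ω → ℝ)
    (ψ : ℝ → ℝ) : Prop where
  measurable : ∀ n, Measurable (Z n)
  integrable_exp : ∀ n c, 0 ≤ c → Integrable (fun w => Real.exp (c * Z n w)) P
  tendsto_mgf : ∀ c, 0 ≤ c →
    Tendsto (fun n : ℕ => ((n : ℝ) + 1) * (mgf (Z n) P c - 1)) atTop (𝓝 (ψ c))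
  tendsto_tail : ∀ ε, 0 < ε →
    Tendsto (fun n : ℕ => ((n : ℝ) + 1) * P.real {w | ε < Z n w}) atTop (𝓝 0)

section

variable {Ω : Type*} [MeasurableSpace Ω] {P : Measure Ω} {Z : ℕ → Ω → ℝ} {ψ : ℝ → ℝ}

lemma IsSmallTimeApprox.integrable_exp_mul_sq (h : IsSmallTimeApprox P Z ψ) (n : ℕ) {c : ℝ}
    (hc : 0 ≤ c) :
    Integrable (fun w => Real.exp (c * Z n w) * (Real.exp (Z n w) - 1) ^ 2) P ∧
    ∫ w, Real.exp (c * Z n w) * (Real.exp (Z n w) - 1) ^ 2 ∂P =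
      mgf (Z n) P (c + 2) - 2 * mgf (Z n) P (c + 1) + mgf (Z n) P c := by
  have h0 := h.integrable_exp n c hc
  have h1 := (h.integrable_exp n (c + 1) (by linarith)).const_mul 2
  have h2 := h.integrable_exp n (c + 2) (by linarith)
  have e : (fun w => Real.exp (c * Z n w) * (Real.exp (Z n w) - 1) ^ 2) = fun w =>
      Real.exp ((c + 2) * Z n w) - 2 * Real.exp ((c + 1) * Z n w) + Real.exp (c * Z n w) := by
    funext w
    rw [show (c + 2) * Z n w = c * Z n w + (Z n w + Z n w) by ring,
      show (c + 1) * Z n w = c * Z n w + Z n w by ring, Real.exp_add, Real.exp_add, Real.exp_add]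
    ring
  rw [e]
  refine ⟨(h2.sub h1).add h0, ?_⟩
  rw [integral_add (f := fun w => _ - _) (h2.sub h1) h0, integral_sub h2 h1, integral_const_mul]
  rfl

/-- In the second difference the constants 1 - 2 + 1 cancel, so these quantities converge, to the
second difference of ψ at c, and are therefore bounded. -/
lemma IsSmallTimeApprox.exists_bound (h : IsSmallTimeApprox P Z ψ) {c : ℝ} (hc : 0 ≤ c) :
    ∃ B, ∀ n : ℕ, ((n : ℝ) + 1) *
      ∫ w, Real.exp (c * Z n w) * (Real.exp (Z n w) - 1) ^ 2 ∂P ≤ B := by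
  have := (((h.tendsto_mgf (c + 2) (by linarith)).sub
    ((h.tendsto_mgf (c + 1) (by linarith)).const_mul 2)).add
    (h.tendsto_mgf c hc)).bddAbove_range
  obtain ⟨B, hB⟩ := this
  refine ⟨B, fun n => ?_⟩
  rw [(h.integrable_exp_mul_sq n hc).2]
  refine le_trans (le_of_eq ?_) (hB ⟨n, rfl⟩)
  ring

lemma IsSmallTimeApprox.integrable_posPart_pow (h : IsSmallTimeApprox P Z ψ) (n : ℕ) {k : ℕ} (hk : k ≠ 0)
    {c : ℝ} (hc : 0 ≤ c) : Integrable (fun w => max (Z n w) 0 ^ k * Real.exp (c * Z n w)) P := by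
  have hm := h.measurable n
  refine ((h.integrable_exp n (c + 1) (by linarith)).const_mul (k.factorial : ℝ)).mono'
    (by fun_prop) (Eventually.of_forall fun w => ?_)
  rw [Real.norm_of_nonneg (by positivity)]
  rcases le_or_gt (Z n w) 0 with hz | hz
  · rw [max_eq_right hz]
    rw [zero_pow hk, zero_mul]; positivity
  · rw [max_eq_left hz.le]
    have := Real.pow_div_factorial_le_exp (Z n w) hz.le k
    rw [div_le_iff₀ (by positivity)] at this
    rw [add_mul, one_mul, Real.exp_add]
    calc _ ≤ (Real.exp (Z n w) * k.factorial) * Real.exp (c * Z n w) := by gcongr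
      _ = _ := by ring

lemma IsSmallTimeApprox.tendsto_third_moment [IsProbabilityMeasure P]
    (h : IsSmallTimeApprox P Z ψ) {c : ℝ} (hc : 0 ≤ c) :
    Tendsto (fun n : ℕ => ((n : ℝ) + 1) * ∫ w, max (Z n w) 0 ^ 3 * Real.exp (c * Z n w) ∂P)
      atTop (𝓝 0) := by
  obtain ⟨B, hB⟩ := h.exists_bound hc
  obtain ⟨B', hB'⟩ := h.exists_bound (c := c + 2) (by linarith)
  have key : ∀ (n : ℕ) (ε M : ℝ), 0 < ε → 1 ≤ M →
      ((n : ℝ) + 1) * ∫ w, max (Z n w) 0 ^ 3 * Real.exp (c * Z n w) ∂P ≤ ε * B +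
        6 * Real.exp (-M) * B' + 6 * Real.exp ((c + 1) * M) *
          (((n : ℝ) + 1) * P.real {w | ε < Z n w}) := by
    intro n ε M hε hM
    have hm := h.measurable n
    have hset : MeasurableSet {w | ε < Z n w} := measurableSet_lt measurable_const hm
    have i1 := (h.integrable_exp_mul_sq n hc).1.const_mul ε
    have i2 := (h.integrable_exp_mul_sq n (c := c + 2) (by linarith)).1.const_mul
      (6 * Real.exp (-M))
    have i3 : Integrable (fun w => 6 * Real.exp ((c + 1) * M) *
        (Set.Ioi ε).indicator (1 : ℝ → ℝ) (Z n w)) P := by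
      refine Integrable.const_mul ?_ _
      exact (integrable_const (1 : ℝ)).indicator hset
    have e3 : ∫ w, (Set.Ioi ε).indicator (1 : ℝ → ℝ) (Z n w) ∂P = P.real {w | ε < Z n w} :=
      integral_indicator_one hset
    have hle := integral_mono (h.integrable_posPart_pow n three_ne_zero hc) ((i1.add i2).add i3)
      (fun w => Real.posPart_cube_mul_exp_le (Z n w) hc hε hM)
    rw [integral_add' (i1.add i2) i3, integral_add' i1 i2, integral_const_mul, integral_const_mul,
      integral_const_mul, e3] at hle
    have hn : (0 : ℝ) ≤ (n : ℝ) + 1 := by positivity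
    have a1 := mul_le_mul_of_nonneg_left hle hn
    have a2 := mul_le_mul_of_nonneg_left (hB n) hε.le
    have a3 := mul_le_mul_of_nonneg_left (hB' n) (show 0 ≤ 6 * Real.exp (-M) by positivity)
    linarith
  have hpos : ∀ n : ℕ, 0 ≤ ((n : ℝ) + 1) * ∫ w, max (Z n w) 0 ^ 3 * Real.exp (c * Z n w) ∂P :=
    fun n => mul_nonneg (by positivity) (integral_nonneg fun w => by positivity)
  have hB0 : ∃ B0 : ℝ, 0 < B0 ∧ B ≤ B0 ∧ B' ≤ B0 :=
    ⟨max 1 (max B B'), by positivity, by simp, by simp⟩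
  obtain ⟨B0, hB0, hBB, hBB'⟩ := hB0
  rw [Metric.tendsto_atTop]
  intro δ hδ
  -- Order of choice: M large from B0 and δ, then ε = δ / (3 B0), then n. Each of the three terms in
  -- `key` is then at most δ / 3.
  have hM : ∀ᶠ M : ℝ in atTop, 6 * Real.exp (-M) * B0 < δ / 3 := by
    have : Tendsto (fun M : ℝ => 6 * Real.exp (-M) * B0) atTop (𝓝 (6 * 0 * B0)) :=
      (Real.tendsto_exp_neg_atTop_nhds_zero.const_mul 6).mul_const B0
    exact this.eventually (gt_mem_nhds (by simpa using by positivity))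
  obtain ⟨M, hM1, hM2⟩ := (hM.and (eventually_ge_atTop 1)).exists
  have ht := (h.tendsto_tail (δ / (3 * B0)) (by positivity)).const_mul
    (6 * Real.exp ((c + 1) * M))
  rw [mul_zero] at ht
  obtain ⟨N, hN⟩ := eventually_atTop.1 (ht.eventually (gt_mem_nhds (show 0 < δ / 3 by positivity)))
  refine ⟨N, fun n hn => ?_⟩
  rw [Real.dist_eq, sub_zero, abs_of_nonneg (hpos n)]
  have k1 := key n (δ / (3 * B0)) M (by positivity) hM2
  have k2 := hN n hn
  have k3 : δ / (3 * B0) * B ≤ δ / 3 := by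
    calc δ / (3 * B0) * B ≤ δ / (3 * B0) * B0 := by gcongr
      _ = δ / 3 := by field_simp
  have k4 : 6 * Real.exp (-M) * B' ≤ 6 * Real.exp (-M) * B0 := by gcongr
  linarith

/-- The linear coefficient contributed by the positive part of the small-time increment. -/
noncomputable def approxDrift (P : Measure Ω) (Z : ℕ → Ω → ℝ) (Φ : ℝ) (n : ℕ) : ℝ :=
  ((n : ℝ) + 1) * ∫ w, max (Z n w) 0 ^ 1 * Real.exp (Φ * Z n w) ∂P

/-- The quadratic coefficient contributed by the positive part of the small-time increment, made
strictly positive. -/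
noncomputable def approxGauss (P : Measure Ω) (Z : ℕ → Ω → ℝ) (Φ : ℝ) (n : ℕ) : ℝ :=
  ((n : ℝ) + 1) / 2 * ∫ w, max (Z n w) 0 ^ 2 * Real.exp (Φ * Z n w) ∂P + 1 / ((n : ℝ) + 1)

/-- The contribution of the negative part of the small-time increment. -/
noncomputable def approxJump (P : Measure Ω) (Z : ℕ → Ω → ℝ) (Φ : ℝ) (n : ℕ) (θ : ℝ) : ℝ :=
  ((n : ℝ) + 1) * ∫ w, Real.exp (Φ * Z n w) * (1 - Real.exp (θ * min (Z n w) 0)) ∂P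

lemma approxDrift_nonneg (Φ : ℝ) (n : ℕ) : 0 ≤ approxDrift P Z Φ n :=
  mul_nonneg (by positivity) (integral_nonneg fun w => by positivity)

lemma approxGauss_pos (Φ : ℝ) (n : ℕ) : 0 < approxGauss P Z Φ n :=
  add_pos_of_nonneg_of_pos (mul_nonneg (by positivity) (integral_nonneg fun w => by positivity))
    (by positivity)

lemma IsSmallTimeApprox.integrable_approxJump (h : IsSmallTimeApprox P Z ψ) {Φ θ : ℝ}
    (hΦ : 0 ≤ Φ) (hθ : 0 ≤ θ) (n : ℕ) :
    Integrable (fun w => Real.exp (Φ * Z n w) * (1 - Real.exp (θ * min (Z n w) 0))) P := by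
  have hm := h.measurable n
  refine (h.integrable_exp n Φ hΦ).mono' (by fun_prop) (Eventually.of_forall fun w => ?_)
  have h1 : Real.exp (θ * min (Z n w) 0) ≤ 1 :=
    Real.exp_le_one_iff.2 (mul_nonpos_of_nonneg_of_nonpos hθ (min_le_right _ _))
  rw [Real.norm_of_nonneg (mul_nonneg (Real.exp_nonneg _) (by linarith))]
  exact mul_le_of_le_one_right (Real.exp_nonneg _) (by linarith [Real.exp_pos (θ * min (Z n w) 0)])

/-- The expansion of e^{ΦZ} (e^{θZ} - 1) is exact where Z ≤ 0. Where Z > 0 it is cut after the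
quadratic term, with an error between 0 and (θZ)³ e^{(Φ+θ)Z}, negligible by `tendsto_third_moment`.
The extra 1/(n+1) in `approxGauss` vanishes in the limit. -/
lemma IsSmallTimeApprox.tendsto_approx [IsProbabilityMeasure P]
    (h : IsSmallTimeApprox P Z ψ) {Φ θ : ℝ} (hΦ : 0 ≤ Φ) (hθ : 0 ≤ θ) :
    Tendsto (fun n => θ * approxDrift P Z Φ n + θ ^ 2 * approxGauss P Z Φ n -
      approxJump P Z Φ n θ) atTop (𝓝 (ψ (Φ + θ) - ψ Φ)) := by
  have hmain := (h.tendsto_mgf (Φ + θ) (by linarith)).sub (h.tendsto_mgf Φ hΦ)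
  have hthird := (h.tendsto_third_moment (c := Φ + θ) (by linarith)).const_mul (θ ^ 3)
  rw [mul_zero] at hthird
  have hinv : Tendsto (fun n : ℕ => θ ^ 2 * (1 / ((n : ℝ) + 1))) atTop (𝓝 0) := by
    simpa using tendsto_one_div_add_atTop_nhds_zero_nat.const_mul (θ ^ 2)
  have hmain' := hmain.add hinv
  rw [add_zero] at hmain'
  have key : ∀ n : ℕ, ∃ r : ℝ, 0 ≤ r ∧
      r ≤ θ ^ 3 * ∫ w, max (Z n w) 0 ^ 3 * Real.exp ((Φ + θ) * Z n w) ∂P ∧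
      mgf (Z n) P (Φ + θ) - mgf (Z n) P Φ =
        θ * (∫ w, max (Z n w) 0 ^ 1 * Real.exp (Φ * Z n w) ∂P) +
        θ ^ 2 / 2 * (∫ w, max (Z n w) 0 ^ 2 * Real.exp (Φ * Z n w) ∂P) -
        (∫ w, Real.exp (Φ * Z n w) * (1 - Real.exp (θ * min (Z n w) 0)) ∂P) + r := by
    intro n
    have i1 := (h.integrable_posPart_pow n one_ne_zero hΦ).const_mul θ
    have i2 := (h.integrable_posPart_pow n two_ne_zero hΦ).const_mul (θ ^ 2 / 2)
    have i3 := h.integrable_approxJump hΦ hθ n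
    have i4 := (h.integrable_exp n (Φ + θ) (by linarith)).sub (h.integrable_exp n Φ hΦ)
    have i5 := (h.integrable_posPart_pow n three_ne_zero (c := Φ + θ) (by linarith)).const_mul
      (θ ^ 3)
    have hpt : ∀ w, 0 ≤ (Real.exp ((Φ + θ) * Z n w) - Real.exp (Φ * Z n w)) -
          (θ * (max (Z n w) 0 ^ 1 * Real.exp (Φ * Z n w)) +
          θ ^ 2 / 2 * (max (Z n w) 0 ^ 2 * Real.exp (Φ * Z n w)) -
          Real.exp (Φ * Z n w) * (1 - Real.exp (θ * min (Z n w) 0))) ∧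
        (Real.exp ((Φ + θ) * Z n w) - Real.exp (Φ * Z n w)) -
          (θ * (max (Z n w) 0 ^ 1 * Real.exp (Φ * Z n w)) +
          θ ^ 2 / 2 * (max (Z n w) 0 ^ 2 * Real.exp (Φ * Z n w)) -
          Real.exp (Φ * Z n w) * (1 - Real.exp (θ * min (Z n w) 0))) ≤
          θ ^ 3 * (max (Z n w) 0 ^ 3 * Real.exp ((Φ + θ) * Z n w)) := by
      intro w
      have hE := Real.exp_pos (Φ * Z n w)
      rw [add_mul, Real.exp_add]
      rcases le_or_gt (Z n w) 0 with hz | hz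
      · rw [max_eq_right hz, min_eq_left hz]
        constructor <;> apply le_of_eq <;> ring
      · rw [max_eq_left hz.le, min_eq_right hz.le, mul_zero, Real.exp_zero]
        have hx : 0 ≤ θ * Z n w := by positivity
        have l1 := Real.quadratic_le_exp_of_nonneg hx
        have l2 := Real.exp_sub_quadratic_le hx
        constructor
        · have := mul_le_mul_of_nonneg_left l1 hE.le
          linarith
        · have := mul_le_mul_of_nonneg_left l2 hE.le
          linarith
    have ir := i4.sub ((i1.add i2).sub i3)
    refine ⟨_, integral_nonneg (μ := P) fun w => (hpt w).1, ?_, ?_⟩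
    · rw [← integral_const_mul]
      exact integral_mono ir i5 fun w => (hpt w).2
    · have e := integral_sub' i4 ((i1.add i2).sub i3)
      rw [integral_sub' (i1.add i2) i3, integral_add' i1 i2,
        integral_sub' (h.integrable_exp n (Φ + θ) (by linarith)) (h.integrable_exp n Φ hΦ),
        integral_const_mul, integral_const_mul] at e
      simp only [Pi.sub_apply, Pi.add_apply] at e
      rw [e]
      simp only [mgf]
      ring
  choose r hr0 hr1 hr using key
  have hrt : Tendsto (fun n : ℕ => ((n : ℝ) + 1) * r n) atTop (𝓝 0) := by
    refine squeeze_zero (fun n => mul_nonneg (by positivity) (hr0 n)) (fun n => ?_) hthird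
    have := mul_le_mul_of_nonneg_left (hr1 n) (show (0 : ℝ) ≤ (n : ℝ) + 1 by positivity)
    linarith
  have := hmain'.sub hrt
  rw [sub_zero] at this
  refine this.congr fun n => ?_
  have := congrArg (fun x => ((n : ℝ) + 1) * x) (hr n)
  simp only [approxDrift, approxGauss, approxJump]
  linear_combination this

end

/-! ### Laplace transforms of measures on the half-line -/

/-- The Laplace transform of a measure on the real line. -/
noncomputable def lapTransform (μ : Measure ℝ) (θ : ℝ) : ENNReal :=
  ∫⁻ x, ENNReal.ofReal (Real.exp (-θ * x)) ∂μ

lemma lapTransform_conv (μ ν : Measure ℝ) [SFinite ν] (θ : ℝ) :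
    lapTransform (μ ∗ ν) θ = lapTransform μ θ * lapTransform ν θ := by
  unfold lapTransform
  rw [Measure.lintegral_conv (by fun_prop), ← lintegral_mul_const _ (by fun_prop)]
  refine lintegral_congr fun x => ?_
  rw [← lintegral_const_mul _ (by fun_prop)]
  refine lintegral_congr fun y => ?_
  rw [← ENNReal.ofReal_mul (Real.exp_nonneg _), ← Real.exp_add, mul_add]

lemma conv_Iio_zero {μ ν : Measure ℝ} [SFinite ν] (hμ : μ (Set.Iio 0) = 0)
    (hν : ν (Set.Iio 0) = 0) : (μ ∗ ν) (Set.Iio 0) = 0 := by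
  rw [← lintegral_indicator_one measurableSet_Iio,
    Measure.lintegral_conv (measurable_one.indicator measurableSet_Iio)]
  refine lintegral_eq_zero_of_ae_eq_zero ?_
  filter_upwards [measure_eq_zero_iff_ae_notMem.1 hμ] with x hx
  refine lintegral_eq_zero_of_ae_eq_zero ?_
  filter_upwards [measure_eq_zero_iff_ae_notMem.1 hν] with y hy
  simp only [Set.mem_Iio, not_lt] at hx hy
  rw [Set.indicator_of_notMem (by simpa using add_nonneg hx hy)]
  rfl

/-- Convolution powers of a measure on the real line. -/
noncomputable def convPow (ν : Measure ℝ) : ℕ → Measure ℝ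
  | 0 => Measure.dirac 0
  | k + 1 => ν ∗ convPow ν k

instance sFinite_convPow (ν : Measure ℝ) [SFinite ν] (k : ℕ) : SFinite (convPow ν k) := by
  induction k with
  | zero => unfold convPow; infer_instance
  | succ k ih => unfold convPow; infer_instance

lemma lapTransform_convPow (ν : Measure ℝ) [SFinite ν] (θ : ℝ) (k : ℕ) :
    lapTransform (convPow ν k) θ = lapTransform ν θ ^ k := by
  induction k with
  | zero => simp [convPow, lapTransform]
  | succ k ih => rw [convPow, lapTransform_conv, ih, pow_succ']

lemma convPow_Iio_zero {ν : Measure ℝ} [SFinite ν] (hν : ν (Set.Iio 0) = 0) (k : ℕ) :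
    convPow ν k (Set.Iio 0) = 0 := by
  induction k with
  | zero => simp [convPow]
  | succ k ih => exact conv_Iio_zero hν ih

/-- The renewal measure `∑ₖ ν^{*k}`. -/
noncomputable def renewalMeasure (ν : Measure ℝ) : Measure ℝ := Measure.sum (convPow ν)

instance sFinite_renewalMeasure (ν : Measure ℝ) [SFinite ν] : SFinite (renewalMeasure ν) := by
  unfold renewalMeasure; infer_instance

lemma lapTransform_renewalMeasure (ν : Measure ℝ) [SFinite ν] (θ : ℝ) :
    lapTransform (renewalMeasure ν) θ = (1 - lapTransform ν θ)⁻¹ := by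
  rw [← ENNReal.tsum_geometric, renewalMeasure, lapTransform, lintegral_sum_measure]
  exact tsum_congr fun k => lapTransform_convPow ν θ k

lemma renewalMeasure_Iio_zero {ν : Measure ℝ} [SFinite ν] (hν : ν (Set.Iio 0) = 0) :
    renewalMeasure ν (Set.Iio 0) = 0 := by
  rw [renewalMeasure, Measure.sum_apply _ measurableSet_Iio]
  simp [convPow_Iio_zero hν]

/-! ### Exponential densities and nondecreasing densities on the half-line -/

lemma lintegral_exp_neg_mul_Ioi {a : ℝ} (ha : 0 < a) :
    ∫⁻ x in Set.Ioi (0 : ℝ), ENNReal.ofReal (Real.exp (-a * x)) = ENNReal.ofReal (1 / a) := by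
  rw [← ofReal_integral_eq_lintegral_ofReal (integrableOn_exp_mul_Ioi (by linarith) 0)
    (Eventually.of_forall fun x => Real.exp_nonneg _), integral_exp_mul_Ioi (by linarith) 0]
  simp

lemma restrict_Ioi_Iio_zero : (volume.restrict (Set.Ioi (0 : ℝ))) (Set.Iio 0) = 0 := by
  rw [Measure.restrict_apply measurableSet_Iio]
  have : Set.Iio (0 : ℝ) ∩ Set.Ioi 0 = ∅ := by
    ext x; simp only [Set.mem_inter_iff, Set.mem_Iio, Set.mem_Ioi, Set.mem_empty_iff_false]
    exact ⟨fun h => by linarith [h.1, h.2], False.elim⟩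
  simp [this]

/-- The measure with Laplace transform `θ ↦ 1 / (d + σ θ)`. -/
noncomputable def driftGaussMeasure (d σ : ℝ) : Measure ℝ :=
  (volume.restrict (Set.Ioi (0 : ℝ))).withDensity
    fun x => ENNReal.ofReal (1 / σ * Real.exp (-(d / σ) * x))

instance sFinite_driftGaussMeasure (d σ : ℝ) : SFinite (driftGaussMeasure d σ) := by
  unfold driftGaussMeasure; infer_instance

lemma lapTransform_driftGaussMeasure {d σ θ : ℝ} (hd : 0 ≤ d) (hσ : 0 < σ) (hθ : 0 < θ) :
    lapTransform (driftGaussMeasure d σ) θ = ENNReal.ofReal (1 / (d + σ * θ)) := by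
  unfold lapTransform driftGaussMeasure
  rw [lintegral_withDensity_eq_lintegral_mul _ (by fun_prop) (by fun_prop)]
  have e : ∀ x : ℝ, ((fun x => ENNReal.ofReal (1 / σ * Real.exp (-(d / σ) * x))) *
      fun x => ENNReal.ofReal (Real.exp (-θ * x))) x =
      ENNReal.ofReal (1 / σ) * ENNReal.ofReal (Real.exp (-(d / σ + θ) * x)) := fun x => by
    rw [Pi.mul_apply, ← ENNReal.ofReal_mul (by positivity), ← ENNReal.ofReal_mul (by positivity),
      mul_assoc, ← Real.exp_add]
    ring_nf
  simp_rw [e]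
  rw [lintegral_const_mul _ (by fun_prop), lintegral_exp_neg_mul_Ioi (by positivity),
    ← ENNReal.ofReal_mul (by positivity)]
  congr 1
  field_simp

lemma withDensity_restrict_Ioi_Iio_zero (f : ℝ → ENNReal) :
    ((volume.restrict (Set.Ioi (0 : ℝ))).withDensity f) (Set.Iio 0) = 0 :=
  withDensity_absolutelyContinuous _ _ restrict_Ioi_Iio_zero

/-- Measures of the form `μ * Lebesgue measure on (0, ∞)` have nondecreasing densities. -/
lemma lintegral_conv_restrict_Ioi_le_shift (μ : Measure ℝ) {f : ℝ → ENNReal} (hf : Measurable f)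
    {h : ℝ} (hh : 0 ≤ h) :
    ∫⁻ x, f x ∂(μ ∗ volume.restrict (Set.Ioi (0 : ℝ))) ≤
      ∫⁻ x, f (x - h) ∂(μ ∗ volume.restrict (Set.Ioi (0 : ℝ))) := by
  rw [Measure.lintegral_conv hf, Measure.lintegral_conv (f := fun x => f (x - h)) (by fun_prop)]
  refine lintegral_mono fun x => ?_
  -- Translating the right-hand integral by h turns its domain y > 0 into y > -h, which contains the
  -- domain on the left.
  rw [← lintegral_indicator measurableSet_Ioi, ← lintegral_indicator measurableSet_Ioi,
    ← lintegral_add_right_eq_self ((Set.Ioi (0 : ℝ)).indicator fun y => f (x + y - h)) h]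
  refine lintegral_mono fun y => ?_
  by_cases hy : 0 < y
  · rw [Set.indicator_of_mem (by exact hy), Set.indicator_of_mem (by exact add_pos_of_pos_of_nonneg hy hh)]
    rw [show x + (y + h) - h = x + y by ring]
  · rw [Set.indicator_of_notMem (by exact hy)]
    exact zero_le

/-! ### Jump tails and the approximating scale measures -/

lemma approxJump_integrand_nonneg {θ : ℝ} (hθ : 0 ≤ θ) (Φ z : ℝ) :
    0 ≤ Real.exp (Φ * z) * (1 - Real.exp (θ * min z 0)) := by
  have : Real.exp (θ * min z 0) ≤ 1 :=
    Real.exp_le_one_iff.2 (mul_nonpos_of_nonneg_of_nonpos hθ (min_le_right _ _))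
  exact mul_nonneg (Real.exp_nonneg _) (by linarith)

/-- The measure on the half-line with Laplace transform
`θ ↦ (n + 1) E[exp (Φ Z) (1 - exp (θ min(Z, 0)))] / θ`. -/
noncomputable def jumpTailMeasure {Ω : Type*} [MeasurableSpace Ω] (P : Measure Ω)
    (Z : ℕ → Ω → ℝ) (Φ : ℝ) (n : ℕ) : Measure ℝ :=
  (volume.restrict (Set.Ioi (0 : ℝ))).withDensity fun u => ENNReal.ofReal ((n : ℝ) + 1) *
    ∫⁻ w, (Set.Iio (-u)).indicator (fun z => ENNReal.ofReal (Real.exp (Φ * z))) (Z n w) ∂P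

instance sFinite_jumpTailMeasure {Ω : Type*} [MeasurableSpace Ω] (P : Measure Ω)
    (Z : ℕ → Ω → ℝ) (Φ : ℝ) (n : ℕ) : SFinite (jumpTailMeasure P Z Φ n) := by
  unfold jumpTailMeasure; infer_instance

/-- For z < 0 the indicator restricts u to (0, -z), where e^{-θu} integrates to (1 - e^{θz}) / θ.
Taking expectations, this identifies j(θ)/θ as the transform of a tilted jump tail. -/
lemma lintegral_exp_mul_indicator_Iio {θ : ℝ} (hθ : 0 < θ) (Φ z : ℝ) :
    ∫⁻ u in Set.Ioi (0 : ℝ), ENNReal.ofReal (Real.exp (-θ * u)) *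
      (Set.Iio (-u)).indicator (fun z => ENNReal.ofReal (Real.exp (Φ * z))) z =
    ENNReal.ofReal (Real.exp (Φ * z) * (1 - Real.exp (θ * min z 0))) * ENNReal.ofReal (1 / θ) := by
  rcases le_or_gt 0 z with hz | hz
  · rw [min_eq_right hz]
    simp only [mul_zero, Real.exp_zero, sub_self, ENNReal.ofReal_zero, zero_mul]
    rw [setLIntegral_eq_zero measurableSet_Ioi]
    intro u hu
    have : z ∉ Set.Iio (-u) := by
      simp only [Set.mem_Iio, not_lt]; linarith [Set.mem_Ioi.1 hu]
    simp [this]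
  rw [min_eq_left hz.le]
  have e : ∀ u : ℝ, ENNReal.ofReal (Real.exp (-θ * u)) *
      (Set.Iio (-u)).indicator (fun z => ENNReal.ofReal (Real.exp (Φ * z))) z =
      (Set.Iio (-z)).indicator (fun u => ENNReal.ofReal (Real.exp (Φ * z)) *
        ENNReal.ofReal (Real.exp (-θ * u))) u := by
    intro u
    by_cases h : z < -u
    · rw [Set.indicator_of_mem (by exact h), Set.indicator_of_mem (Set.mem_Iio.2 (by linarith)),
        mul_comm]
    · rw [Set.indicator_of_notMem (by exact h),
        Set.indicator_of_notMem (by simp only [Set.mem_Iio]; intro h'; exact h (by linarith)),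
        mul_zero]
  simp_rw [e]
  rw [lintegral_indicator measurableSet_Iio, Measure.restrict_restrict measurableSet_Iio,
    lintegral_const_mul _ (by fun_prop), Set.inter_comm, Set.Ioi_inter_Iio]
  have hint : IntegrableOn (fun u => Real.exp (-θ * u)) (Set.Ioo 0 (-z)) :=
    (integrableOn_exp_mul_Ioi (by linarith) 0).mono_set Set.Ioo_subset_Ioi_self
  rw [← ofReal_integral_eq_lintegral_ofReal hint
    (Eventually.of_forall fun x => Real.exp_nonneg _), ← integral_Ioc_eq_integral_Ioo,
    ← intervalIntegral.integral_of_le (by linarith)]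
  have hi : ∫ u in (0 : ℝ)..(-z), Real.exp (-θ * u) = (1 - Real.exp (θ * z)) * (1 / θ) := by
    rw [intervalIntegral.integral_comp_mul_left (fun x => Real.exp x) (by linarith), integral_exp]
    simp only [mul_zero, Real.exp_zero, smul_eq_mul, neg_mul_neg]
    field_simp
    ring
  have h1 : Real.exp (θ * z) ≤ 1 := Real.exp_le_one_iff.2 (by nlinarith)
  rw [hi, ← ENNReal.ofReal_mul (by positivity), ← ENNReal.ofReal_mul
    (mul_nonneg (Real.exp_nonneg _) (by linarith)), mul_assoc]

lemma IsSmallTimeApprox.lapTransform_jumpTailMeasure {Ω : Type*} [MeasurableSpace Ω]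
    {P : Measure Ω} [IsProbabilityMeasure P] {Z : ℕ → Ω → ℝ} {ψ : ℝ → ℝ}
    (h : IsSmallTimeApprox P Z ψ) {Φ θ : ℝ} (hΦ : 0 ≤ Φ) (hθ : 0 < θ) (n : ℕ) :
    lapTransform (jumpTailMeasure P Z Φ n) θ =
      ENNReal.ofReal (approxJump P Z Φ n θ / θ) := by
  have hm := h.measurable n
  have hjoint : Measurable (fun p : ℝ × Ω => (Set.Iio (-p.1)).indicator
      (fun z => ENNReal.ofReal (Real.exp (Φ * z))) (Z n p.2)) := by
    have : (fun p : ℝ × Ω => (Set.Iio (-p.1)).indicator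
        (fun z => ENNReal.ofReal (Real.exp (Φ * z))) (Z n p.2)) =
        {p : ℝ × Ω | Z n p.2 < -p.1}.indicator
          (fun p => ENNReal.ofReal (Real.exp (Φ * Z n p.2))) := by
      funext p
      simp [Set.indicator]
    rw [this]
    refine Measurable.indicator (by fun_prop) (measurableSet_lt (by fun_prop) (by fun_prop))
  unfold lapTransform jumpTailMeasure
  rw [lintegral_withDensity_eq_lintegral_mul _ (hjoint.lintegral_prod_right'.const_mul _)
    (by fun_prop)]
  have e : ∀ u : ℝ, ((fun u => ENNReal.ofReal ((n : ℝ) + 1) *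
      ∫⁻ w, (Set.Iio (-u)).indicator (fun z => ENNReal.ofReal (Real.exp (Φ * z))) (Z n w) ∂P) *
      fun x => ENNReal.ofReal (Real.exp (-θ * x))) u = ENNReal.ofReal ((n : ℝ) + 1) *
      ∫⁻ w, ENNReal.ofReal (Real.exp (-θ * u)) *
        (Set.Iio (-u)).indicator (fun z => ENNReal.ofReal (Real.exp (Φ * z))) (Z n w) ∂P := by
    intro u
    rw [Pi.mul_apply, lintegral_const_mul _ (by exact hjoint.comp measurable_prodMk_left)]
    ring
  simp_rw [e]
  have hj2 : Measurable (fun p : ℝ × Ω => ENNReal.ofReal (Real.exp (-θ * p.1)) *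
      (Set.Iio (-p.1)).indicator (fun z => ENNReal.ofReal (Real.exp (Φ * z))) (Z n p.2)) :=
    Measurable.mul (by fun_prop) hjoint
  rw [lintegral_const_mul _ hj2.lintegral_prod_right', lintegral_lintegral_swap hj2.aemeasurable]
  simp_rw [lintegral_exp_mul_indicator_Iio hθ]
  rw [lintegral_mul_const _ (by fun_prop), ← ofReal_integral_eq_lintegral_ofReal
    (h.integrable_approxJump hΦ hθ.le n), ← mul_assoc, ← ENNReal.ofReal_mul (by positivity),
    ← ENNReal.ofReal_mul' (by positivity), approxJump, mul_one_div]
  exact Eventually.of_forall fun w => approxJump_integrand_nonneg hθ.le _ _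

/-- Measures on the half-line whose Laplace transforms approximate `1 / (ψ (Φ + θ) - ψ Φ)`. -/
noncomputable def approxScaleMeasure {Ω : Type*} [MeasurableSpace Ω] (P : Measure Ω)
    (Z : ℕ → Ω → ℝ) (Φ : ℝ) (n : ℕ) : Measure ℝ :=
  (driftGaussMeasure (approxDrift P Z Φ n) (approxGauss P Z Φ n) ∗
    renewalMeasure (jumpTailMeasure P Z Φ n ∗
      driftGaussMeasure (approxDrift P Z Φ n) (approxGauss P Z Φ n))) ∗
    volume.restrict (Set.Ioi (0 : ℝ))

lemma approxScaleMeasure_Iio_zero {Ω : Type*} [MeasurableSpace Ω] (P : Measure Ω)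
    (Z : ℕ → Ω → ℝ) (Φ : ℝ) (n : ℕ) : approxScaleMeasure P Z Φ n (Set.Iio 0) = 0 :=
  conv_Iio_zero (conv_Iio_zero (withDensity_restrict_Ioi_Iio_zero _)
    (renewalMeasure_Iio_zero (conv_Iio_zero (withDensity_restrict_Ioi_Iio_zero _)
      (withDensity_restrict_Ioi_Iio_zero _)))) restrict_Ioi_Iio_zero

/-- The three convolution factors contribute 1/(d + σθ), the geometric series 1/(1 - (j/θ)/(d + σθ))
and 1/θ. The hypothesis `hpos` is what keeps the ratio of the series below 1. -/
lemma IsSmallTimeApprox.lapTransform_approxScaleMeasure {Ω : Type*} [MeasurableSpace Ω]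
    {P : Measure Ω} [IsProbabilityMeasure P] {Z : ℕ → Ω → ℝ} {ψ : ℝ → ℝ}
    (h : IsSmallTimeApprox P Z ψ) {Φ θ : ℝ} (hΦ : 0 ≤ Φ) (hθ : 0 < θ) (n : ℕ)
    (hpos : 0 < θ * approxDrift P Z Φ n + θ ^ 2 * approxGauss P Z Φ n - approxJump P Z Φ n θ) :
    lapTransform (approxScaleMeasure P Z Φ n) θ = ENNReal.ofReal
      (1 / (θ * approxDrift P Z Φ n + θ ^ 2 * approxGauss P Z Φ n - approxJump P Z Φ n θ)) := by
  have hd : 0 ≤ approxDrift P Z Φ n := approxDrift_nonneg Φ n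
  have hσ : 0 < approxGauss P Z Φ n := approxGauss_pos Φ n
  unfold approxScaleMeasure
  rw [lapTransform_conv, lapTransform_conv, lapTransform_renewalMeasure, lapTransform_conv,
    h.lapTransform_jumpTailMeasure hΦ hθ, lapTransform_driftGaussMeasure hd hσ hθ]
  have hleb : lapTransform (volume.restrict (Set.Ioi (0 : ℝ))) θ = ENNReal.ofReal (1 / θ) :=
    lintegral_exp_neg_mul_Ioi hθ
  rw [hleb]
  set d := approxDrift P Z Φ n
  set σ := approxGauss P Z Φ n
  set j := approxJump P Z Φ n θ
  have hD : 0 < d + σ * θ := by positivity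
  have hj : j / θ * (1 / (d + σ * θ)) < 1 := by
    rw [mul_one_div, div_lt_one hD, div_lt_iff₀ hθ]
    nlinarith
  rw [← ENNReal.ofReal_mul' (by positivity), ← ENNReal.ofReal_one]
  have hsub : ENNReal.ofReal 1 - ENNReal.ofReal (j / θ * (1 / (d + σ * θ))) =
      ENNReal.ofReal (1 - j / θ * (1 / (d + σ * θ))) := by
    rw [ENNReal.ofReal_sub]
    have : 0 ≤ j := mul_nonneg (by positivity)
      (integral_nonneg fun w => approxJump_integrand_nonneg hθ.le _ _)
    positivity
  rw [hsub, ← ENNReal.ofReal_inv_of_pos (by linarith), ← ENNReal.ofReal_mul (by positivity),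
    ← ENNReal.ofReal_mul' (by positivity)]
  congr 1
  have : θ * (d + σ * θ) - j ≠ 0 := by nlinarith
  have h2 : 1 - j / θ * (1 / (d + σ * θ)) = (θ * d + θ ^ 2 * σ - j) / (θ * (d + σ * θ)) := by
    field_simp
  rw [h2]
  field_simp

/-! ### Monotone densities and convergence of Laplace transforms -/

lemma integrable_comp_of_ae_mem_Icc {μ : Measure ℝ} [IsFiniteMeasure μ] {T : ℝ → ℝ}
    (hT : Measurable T) (h01 : ∀ᵐ x ∂μ, T x ∈ Set.Icc (0 : ℝ) 1) {g : ℝ → ℝ} (hg : Continuous g) :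
    Integrable (fun x => g (T x)) μ := by
  obtain ⟨C, hC⟩ := (isCompact_Icc (a := (0 : ℝ)) (b := 1)).exists_bound_of_continuousOn
    hg.continuousOn
  exact (integrable_const C).mono' (hg.measurable.comp hT).aestronglyMeasurable
    (h01.mono fun x hx => hC _ hx)

lemma abs_integral_comp_sub_le {μ : Measure ℝ} [IsFiniteMeasure μ] {T : ℝ → ℝ}
    (hT : Measurable T) (h01 : ∀ᵐ x ∂μ, T x ∈ Set.Icc (0 : ℝ) 1) {g p : ℝ → ℝ} (hg : Continuous g)
    (hp : Continuous p) {δ : ℝ} (hδ : ∀ s ∈ Set.Icc (0 : ℝ) 1, |p s - g s| ≤ δ) :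
    |(∫ x, p (T x) ∂μ) - ∫ x, g (T x) ∂μ| ≤ δ * μ.real Set.univ := by
  rw [← integral_sub (integrable_comp_of_ae_mem_Icc hT h01 hp)
    (integrable_comp_of_ae_mem_Icc hT h01 hg)]
  exact norm_integral_le_of_norm_le_const (f := fun x => p (T x) - g (T x))
    (h01.mono fun x hx => hδ _ hx)

/-- The method of moments for finite measures carried by `[0, 1]`. -/
lemma tendsto_integral_comp_of_tendsto_moments {μ : ℕ → Measure ℝ} {ν : Measure ℝ}
    [∀ n, IsFiniteMeasure (μ n)] [IsFiniteMeasure ν] {T : ℝ → ℝ} (hT : Measurable T)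
    (hμ : ∀ n, ∀ᵐ x ∂μ n, T x ∈ Set.Icc (0 : ℝ) 1) (hν : ∀ᵐ x ∂ν, T x ∈ Set.Icc (0 : ℝ) 1)
    (hmom : ∀ k : ℕ, Tendsto (fun n => ∫ x, T x ^ k ∂μ n) atTop (𝓝 (∫ x, T x ^ k ∂ν)))
    {g : ℝ → ℝ} (hg : Continuous g) :
    Tendsto (fun n => ∫ x, g (T x) ∂μ n) atTop (𝓝 (∫ x, g (T x) ∂ν)) := by
  have hpoly : ∀ p : Polynomial ℝ,
      Tendsto (fun n => ∫ x, p.eval (T x) ∂μ n) atTop (𝓝 (∫ x, p.eval (T x) ∂ν)) := by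
    intro p
    have e : ∀ (κ : Measure ℝ) [IsFiniteMeasure κ], (∀ᵐ x ∂κ, T x ∈ Set.Icc (0 : ℝ) 1) →
        ∫ x, p.eval (T x) ∂κ =
          ∑ i ∈ Finset.range (p.natDegree + 1), p.coeff i * ∫ x, T x ^ i ∂κ := by
      intro κ _ hκ
      simp_rw [Polynomial.eval_eq_sum_range]
      rw [integral_finsetSum]
      · simp_rw [integral_const_mul]
      · intro i _
        exact (integrable_comp_of_ae_mem_Icc hT hκ (g := fun s => s ^ i) (by fun_prop)).const_mul _
    simp_rw [e _ (hμ _), e ν hν]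
    exact tendsto_finsetSum _ fun i _ => (hmom i).const_mul _
  -- The moment of order 0 is the total mass, so the masses are bounded by a common B and polynomial
  -- approximation on [0, 1] is uniform in n.
  have hmass := hmom 0
  simp only [pow_zero, integral_const, smul_eq_mul, mul_one] at hmass
  obtain ⟨B, hB⟩ := hmass.bddAbove_range
  have hB' : ∀ n, (μ n).real Set.univ ≤ B := fun n => hB ⟨n, rfl⟩
  have hB0 : 0 ≤ B := measureReal_nonneg.trans (hB' 0)
  have hBν : ν.real Set.univ ≤ B := le_of_tendsto' hmass hB'
  rw [Metric.tendsto_atTop]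
  intro ε hε
  obtain ⟨p, hp⟩ := exists_polynomial_near_of_continuousOn 0 1 g hg.continuousOn
    (ε / (3 * (B + 1))) (by positivity)
  obtain ⟨N, hN⟩ := Metric.tendsto_atTop.1 (hpoly p) (ε / 3) (by positivity)
  refine ⟨N, fun n hn => ?_⟩
  have h1 := abs_integral_comp_sub_le hT (hμ n) hg p.continuous fun s hs => (hp s hs).le
  have h2 := abs_integral_comp_sub_le hT hν hg p.continuous fun s hs => (hp s hs).le
  have h3 := hN n hn
  rw [Real.dist_eq] at h3 ⊢
  have hb : ∀ m : ℝ, m ≤ B → ε / (3 * (B + 1)) * m ≤ ε / 3 := fun m hm => by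
    calc ε / (3 * (B + 1)) * m ≤ ε / (3 * (B + 1)) * (B + 1) := by gcongr; linarith
      _ = ε / 3 := by field_simp
  have h1' := abs_le.1 (h1.trans (hb _ (hB' n)))
  have h2' := abs_le.1 (h2.trans (hb _ hBν))
  have h3' := abs_lt.1 h3
  rw [abs_lt]
  constructor <;> linarith [h1'.1, h1'.2, h2'.1, h2'.2, h3'.1, h3'.2]

/-- A strict violation at a persists on some [a, b) by right continuity, and a bump supported there
contradicts the integrated inequality. The test functions are written in e^{-x}, with weight e^{-x},
because that is the form the method of moments delivers. -/
lemma le_of_integral_mul_shift_le {V : ℝ → ℝ} (hV0 : ∀ x, 0 ≤ V x) (hVneg : ∀ x < 0, V x = 0)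
    (hVc : ContinuousOn V (Set.Ici 0)) {h : ℝ} (hh : 0 ≤ h)
    (hint : ∀ g : ℝ → ℝ, Continuous g → (∀ s, 0 ≤ g s) →
      Integrable (fun x => V x * (Real.exp (-x) * g (Real.exp (-x)))) ∧
      Integrable (fun x => V (x + h) * (Real.exp (-x) * g (Real.exp (-x)))) ∧
      ∫ x, V x * (Real.exp (-x) * g (Real.exp (-x))) ≤
        ∫ x, V (x + h) * (Real.exp (-x) * g (Real.exp (-x)))) (a : ℝ) : V a ≤ V (a + h) := by
  by_contra! hlt
  have ha : 0 ≤ a := by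
    by_contra! hneg
    rw [hVneg a hneg] at hlt
    exact absurd (hV0 (a + h)) (not_le.2 hlt)
  have c1 : ContinuousWithinAt V (Set.Ici a) a :=
    (hVc a ha).mono (Set.Ici_subset_Ici.2 ha)
  have c2 : ContinuousWithinAt (fun x => V (x + h)) (Set.Ici a) a := by
    refine ContinuousWithinAt.comp (t := Set.Ici 0) (hVc (a + h) (by simp; linarith)) (by fun_prop) ?_
    intro x hx
    simp only [Set.mem_Ici] at hx ⊢
    linarith
  have hev : ∀ᶠ x in 𝓝[≥] a, V (x + h) < V x := c2.eventually_lt c1 hlt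
  obtain ⟨b, hab, hb⟩ := (mem_nhdsGE_iff_exists_Ico_subset).1 hev
  have hab' : a < b := hab
  -- As a function of s = e^{-x}, this is positive exactly when a < x < b.
  set g : ℝ → ℝ := fun s => max 0 (s - Real.exp (-b)) * max 0 (Real.exp (-a) - s) with hg
  obtain ⟨i1, i2, hle⟩ := hint g (by fun_prop) (fun s => by positivity)
  have hdiff : ∀ x, V x * (Real.exp (-x) * g (Real.exp (-x))) -
      V (x + h) * (Real.exp (-x) * g (Real.exp (-x))) =
      (V x - V (x + h)) * (Real.exp (-x) * g (Real.exp (-x))) := fun x => by ring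
  have hi : Integrable (fun x => (V x - V (x + h)) * (Real.exp (-x) * g (Real.exp (-x)))) :=
    (i1.sub i2).congr (Eventually.of_forall hdiff)
  have hI : ∫ x, (V x - V (x + h)) * (Real.exp (-x) * g (Real.exp (-x))) ≤ 0 := by
    simp_rw [← hdiff]
    rw [integral_sub i1 i2]
    linarith
  have hpos : ∀ x, x ∈ Set.Ioo a b → 0 < (V x - V (x + h)) * (Real.exp (-x) * g (Real.exp (-x))) := by
    intro x hx
    have h1 : V (x + h) < V x := hb ⟨hx.1.le, hx.2⟩
    have h2 : Real.exp (-b) < Real.exp (-x) := Real.exp_lt_exp.2 (by linarith [hx.2])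
    have h3 : Real.exp (-x) < Real.exp (-a) := Real.exp_lt_exp.2 (by linarith [hx.1])
    refine mul_pos (by linarith) (mul_pos (Real.exp_pos _) (mul_pos ?_ ?_))
    · exact lt_max_of_lt_right (by linarith)
    · exact lt_max_of_lt_right (by linarith)
  have hzero : ∀ x, x ∉ Set.Ioo a b → (V x - V (x + h)) * (Real.exp (-x) * g (Real.exp (-x))) = 0 := by
    intro x hx
    have : g (Real.exp (-x)) = 0 := by
      rw [Set.mem_Ioo, not_and_or, not_lt, not_lt] at hx
      rcases hx with hx | hx
      · have : Real.exp (-a) ≤ Real.exp (-x) := Real.exp_le_exp.2 (by linarith)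
        simp only [hg]
        rw [max_eq_left (b := Real.exp (-a) - Real.exp (-x)) (by linarith), mul_zero]
      · have : Real.exp (-x) ≤ Real.exp (-b) := Real.exp_le_exp.2 (by linarith)
        simp only [hg]
        rw [max_eq_left (b := Real.exp (-x) - Real.exp (-b)) (by linarith), zero_mul]
    rw [this]; ring
  have hnn : ∀ x, 0 ≤ (V x - V (x + h)) * (Real.exp (-x) * g (Real.exp (-x))) := fun x => by
    by_cases hx : x ∈ Set.Ioo a b
    · exact (hpos x hx).le
    · exact (hzero x hx).ge
  have hP := (integral_pos_iff_support_of_nonneg hnn hi).2 (lt_of_lt_of_le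
    (b := volume (Set.Ioo a b)) (by simpa using hab') (measure_mono fun x hx => (hpos x hx).ne'))
  linarith

lemma lintegral_ofReal_withDensity_exp (μ : Measure ℝ) {g : ℝ → ℝ} (hg : Measurable g) :
    ∫⁻ x, ENNReal.ofReal (g x) ∂(μ.withDensity fun x => ENNReal.ofReal (Real.exp (-x))) =
      ∫⁻ x, ENNReal.ofReal (Real.exp (-x) * g x) ∂μ := by
  rw [lintegral_withDensity_eq_lintegral_mul _ (by fun_prop) (by fun_prop)]
  refine lintegral_congr fun x => ?_
  rw [Pi.mul_apply, ENNReal.ofReal_mul (Real.exp_nonneg _)]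

lemma exp_neg_mem_Icc {x : ℝ} (hx : 0 ≤ x) : Real.exp (-x) ∈ Set.Icc (0 : ℝ) 1 :=
  ⟨Real.exp_nonneg _, Real.exp_le_one_iff.2 (by linarith)⟩

/-- If the Laplace transforms of measures with nondecreasing densities on the half-line converge to
that of `V`, then `V` is nondecreasing. -/
lemma monotone_of_tendsto_lapTransform {V : ℝ → ℝ} (hVm : Measurable V) (hV0 : ∀ x, 0 ≤ V x)
    (hVneg : ∀ x < 0, V x = 0) (hVc : ContinuousOn V (Set.Ici 0))
    (hVi : Integrable (fun x => Real.exp (-x) * V x))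
    {μ : ℕ → Measure ℝ} (hμ0 : ∀ n, μ n (Set.Iio 0) = 0)
    (hshift : ∀ n, ∀ f : ℝ → ENNReal, Measurable f → ∀ h, 0 ≤ h →
      ∫⁻ x, f x ∂μ n ≤ ∫⁻ x, f (x - h) ∂μ n)
    (hfin : ∀ n, lapTransform (μ n) 1 ≠ ⊤)
    (hlap : ∀ k : ℕ, Tendsto (fun n => lapTransform (μ n) (k + 1)) atTop
      (𝓝 (ENNReal.ofReal (∫ x, Real.exp (-(k + 1) * x) * V x)))) : Monotone V := by
  -- The weight e^{-x} makes the measures finite, and s = e^{-x} takes values in [0, 1] on the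
  -- half-line. The k-th moment of s is then the Laplace transform at k + 1.
  set μ' : ℕ → Measure ℝ := fun n =>
    (μ n).withDensity fun x => ENNReal.ofReal (Real.exp (-x)) with hμ'
  set ν : Measure ℝ := volume.withDensity fun x => ENNReal.ofReal (Real.exp (-x) * V x) with hν
  have hfin' : ∀ n, IsFiniteMeasure (μ' n) := fun n => by
    refine isFiniteMeasure_withDensity ?_
    have := hfin n
    simpa [lapTransform] using this
  have hνfin : IsFiniteMeasure ν := isFiniteMeasure_withDensity_ofReal hVi.2
  have hT : Measurable (fun x : ℝ => Real.exp (-x)) := by fun_prop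
  have h01 : ∀ n, ∀ᵐ x ∂μ' n, Real.exp (-x) ∈ Set.Icc (0 : ℝ) 1 := fun n => by
    refine (withDensity_absolutelyContinuous (μ n) _).ae_le ?_
    filter_upwards [measure_eq_zero_iff_ae_notMem.1 (hμ0 n)] with x hx
    exact exp_neg_mem_Icc (by simpa using hx)
  have hν01 : ∀ᵐ x ∂ν, Real.exp (-x) ∈ Set.Icc (0 : ℝ) 1 := by
    rw [hν, ae_withDensity_iff (by fun_prop)]
    refine Eventually.of_forall fun x hx => ?_
    refine exp_neg_mem_Icc ?_
    by_contra! hneg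
    exact hx (by simp [hVneg x hneg])
  have hνint : ∀ g : ℝ → ℝ, ∫ x, g (Real.exp (-x)) ∂ν =
      ∫ x, V x * (Real.exp (-x) * g (Real.exp (-x))) := by
    intro g
    rw [hν, integral_withDensity_eq_integral_toReal_smul (by fun_prop)
      (Eventually.of_forall fun _ => ENNReal.ofReal_lt_top)]
    refine integral_congr_ae (Eventually.of_forall fun x => ?_)
    simp only [smul_eq_mul]
    rw [ENNReal.toReal_ofReal (mul_nonneg (Real.exp_nonneg _) (hV0 x))]
    ring
  have hνI : ∀ g : ℝ → ℝ, Continuous g →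
      Integrable (fun x => V x * (Real.exp (-x) * g (Real.exp (-x)))) := by
    intro g hg
    have := integrable_comp_of_ae_mem_Icc hT hν01 hg
    rw [hν, integrable_withDensity_iff_integrable_smul' (by fun_prop)
      (Eventually.of_forall fun _ => ENNReal.ofReal_lt_top)] at this
    refine this.congr (Eventually.of_forall fun x => ?_)
    simp only [smul_eq_mul]
    rw [ENNReal.toReal_ofReal (mul_nonneg (Real.exp_nonneg _) (hV0 x))]
    ring
  have hmom : ∀ k : ℕ, Tendsto (fun n => ∫ x, Real.exp (-x) ^ k ∂μ' n) atTop
      (𝓝 (∫ x, Real.exp (-x) ^ k ∂ν)) := by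
    intro k
    have hpow : ∀ x : ℝ, Real.exp (-x) * Real.exp (-x) ^ k = Real.exp (-(k + 1) * x) := fun x => by
      rw [← Real.exp_nat_mul, ← Real.exp_add]; ring_nf
    have e1 : ∀ n, ∫ x, Real.exp (-x) ^ k ∂μ' n = (lapTransform (μ n) (k + 1)).toReal := fun n => by
      rw [integral_eq_lintegral_of_nonneg_ae (Eventually.of_forall fun x => by positivity)
        (by fun_prop), lintegral_ofReal_withDensity_exp _ (by fun_prop)]
      simp_rw [hpow]
      rfl
    have e2 : ∫ x, Real.exp (-x) ^ k ∂ν = ∫ x, Real.exp (-(k + 1) * x) * V x := by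
      rw [hνint fun s => s ^ k]
      simp_rw [hpow, mul_comm]
    simp_rw [e1, e2]
    have := (ENNReal.tendsto_toReal ENNReal.ofReal_ne_top).comp (hlap k)
    rwa [ENNReal.toReal_ofReal (integral_nonneg fun x =>
      mul_nonneg (Real.exp_nonneg _) (hV0 x))] at this
  intro a b hab
  have hh : 0 ≤ b - a := sub_nonneg.2 hab
  obtain ⟨h, hhdef⟩ : ∃ h, h = b - a := ⟨_, rfl⟩
  rw [← hhdef] at hh
  rw [show b = a + h by linarith]
  refine le_of_integral_mul_shift_le hV0 hVneg hVc hh (fun g hg hg0 => ?_) a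
  -- Replacing x by x - h multiplies s = e^{-x} by e^h, both in the argument of g and in the weight.
  set gh : ℝ → ℝ := fun s => Real.exp h * g (Real.exp h * s) with hgh
  have hghc : Continuous gh := by fun_prop
  have hgh0 : ∀ s, 0 ≤ gh s := fun s => mul_nonneg (Real.exp_nonneg _) (hg0 _)
  have hexp : ∀ x, V x * (Real.exp (-x) * gh (Real.exp (-x))) =
      V ((x - h) + h) * (Real.exp (-(x - h)) * g (Real.exp (-(x - h)))) := fun x => by
    have : Real.exp (-(x - h)) = Real.exp h * Real.exp (-x) := by
      rw [← Real.exp_add]; ring_nf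
    rw [sub_add_cancel, this]
    simp only [hgh]
    ring
  have hle : ∀ n, ∫ x, g (Real.exp (-x)) ∂μ' n ≤ ∫ x, gh (Real.exp (-x)) ∂μ' n := by
    intro n
    have i1 := integrable_comp_of_ae_mem_Icc hT (h01 n) hg
    have i2 := integrable_comp_of_ae_mem_Icc hT (h01 n) hghc
    rw [← ENNReal.ofReal_le_ofReal_iff (integral_nonneg fun x => hgh0 _),
      ofReal_integral_eq_lintegral_ofReal i1 (Eventually.of_forall fun x => hg0 _),
      ofReal_integral_eq_lintegral_ofReal i2 (Eventually.of_forall fun x => hgh0 _),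
      lintegral_ofReal_withDensity_exp _ (by fun_prop),
      lintegral_ofReal_withDensity_exp _ (by fun_prop)]
    refine (hshift n (fun x => ENNReal.ofReal (Real.exp (-x) * g (Real.exp (-x)))) (by fun_prop) h
      hh).trans (le_of_eq (lintegral_congr fun x => ?_))
    have : Real.exp (-(x - h)) = Real.exp h * Real.exp (-x) := by
      rw [← Real.exp_add]; ring_nf
    rw [this]
    simp only [hgh]
    ring_nf
  have hlim := le_of_tendsto_of_tendsto'
    (tendsto_integral_comp_of_tendsto_moments hT h01 hν01 hmom hg)
    (tendsto_integral_comp_of_tendsto_moments hT h01 hν01 hmom hghc) hle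
  rw [hνint, hνint] at hlim
  refine ⟨hνI g hg, ?_, ?_⟩
  · have := (hνI gh hghc)
    simp_rw [hexp] at this
    have h2 := this.comp_add_right h
    simpa using h2
  · refine hlim.trans (le_of_eq ?_)
    simp_rw [hexp]
    exact integral_sub_right_eq_self
      (fun x => V (x + h) * (Real.exp (-x) * g (Real.exp (-x)))) h

/-! ### Monotonicity of the tilted scale function -/

lemma exponentInverse_nonneg (ψ : ℝ → ℝ) (q : ℝ) : 0 ≤ exponentInverse ψ q :=
  Real.sInf_nonneg fun _ hc => hc.1

lemma IsScaleFunction.measurable {ψ : ℝ → ℝ} {q : ℝ} {W : ℝ → ℝ} (hW : IsScaleFunction ψ q W) :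
    Measurable W := by
  have : W = (Set.Ici 0).piecewise W 0 := by
    funext x
    by_cases hx : 0 ≤ x
    · rw [Set.piecewise_eq_of_mem _ _ _ (by exact hx)]
    · rw [Set.piecewise_eq_of_notMem _ _ _ (by exact hx), hW.zero_of_neg x (not_le.1 hx)]; rfl
  rw [this]
  exact hW.continuousOn.measurable_piecewise continuousOn_const measurableSet_Ici

/-- The transform of the nonnegative W would be 1/(ψ(θ) - q) ≤ 0, where 1/0 = 0 covers equality. So
W vanishes almost everywhere, and everywhere by right continuity. -/
lemma IsScaleFunction.eq_zero_of_le {ψ : ℝ → ℝ} {q : ℝ} {W : ℝ → ℝ} (hW : IsScaleFunction ψ q W)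
    {θ : ℝ} (hθ : exponentInverse ψ q < θ) (hle : ψ θ ≤ q) (x : ℝ) : W x = 0 := by
  rcases lt_or_ge x 0 with hx | hx
  · exact hW.zero_of_neg x hx
  have hnn : ∀ x, 0 ≤ Real.exp (-θ * x) * W x := fun x =>
    mul_nonneg (Real.exp_nonneg _) (hW.nonneg x)
  have hI : ∫ x in Set.Ici 0, Real.exp (-θ * x) * W x = 0 := by
    refine le_antisymm ?_ (integral_nonneg hnn)
    rw [hW.laplace θ hθ]
    exact one_div_nonpos.2 (by linarith)
  have hae := (integral_eq_zero_iff_of_nonneg hnn (hW.integrableOn θ hθ)).1 hI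
  have hae' : W =ᵐ[volume.restrict (Set.Ici 0)] fun _ => (0 : ℝ) := by
    filter_upwards [hae] with y hy
    exact (mul_eq_zero.1 hy).resolve_left (Real.exp_pos _).ne'
  by_contra hne
  have hpos : 0 < W x := lt_of_le_of_ne (hW.nonneg x) (Ne.symm hne)
  have hc : ContinuousWithinAt W (Set.Ici x) x :=
    (hW.continuousOn x hx).mono (Set.Ici_subset_Ici.2 hx)
  obtain ⟨b, hb, hsub⟩ := mem_nhdsGE_iff_exists_Ico_subset.1 (hc.eventually (lt_mem_nhds hpos))
  have h0 : volume ({y | ¬ W y = 0} ∩ Set.Ici 0) = 0 := by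
    rw [← Measure.restrict_apply' measurableSet_Ici]
    exact hae'
  have h1 : volume (Set.Ico x b) = 0 := by
    refine measure_mono_null (fun y hy => ?_) h0
    exact ⟨ne_of_gt (hsub hy), hx.trans hy.1⟩
  rw [Real.volume_Ico, ENNReal.ofReal_eq_zero] at h1
  have : x < b := hb
  linarith

lemma tendsto_mul_exp_div_sub_one (a : ℝ) :
    Tendsto (fun n : ℕ => ((n : ℝ) + 1) * (Real.exp (a / ((n : ℝ) + 1)) - 1)) atTop (𝓝 a) := by
  have h0 : Tendsto (fun n : ℕ => a / ((n : ℝ) + 1)) atTop (𝓝 0) := by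
    simpa [div_eq_mul_inv] using tendsto_one_div_add_atTop_nhds_zero_nat.const_mul a
  have h1 : Tendsto (fun n : ℕ => a * Real.exp (a / ((n : ℝ) + 1))) atTop (𝓝 a) := by
    simpa using ((Real.continuous_exp.tendsto 0).comp h0).const_mul a
  refine tendsto_of_tendsto_of_tendsto_of_le_of_le tendsto_const_nhds h1 (fun n => ?_) (fun n => ?_)
  · have := Real.add_one_le_exp (a / ((n : ℝ) + 1))
    calc a = ((n : ℝ) + 1) * (a / ((n : ℝ) + 1)) := by field_simp
      _ ≤ _ := by gcongr; linarith
  · have h2 := Real.add_one_le_exp (-(a / ((n : ℝ) + 1)))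
    have h3 : Real.exp (a / ((n : ℝ) + 1)) - 1 ≤
        a / ((n : ℝ) + 1) * Real.exp (a / ((n : ℝ) + 1)) := by
      have h4 := mul_le_mul_of_nonneg_right h2 (Real.exp_nonneg (a / ((n : ℝ) + 1)))
      rw [← Real.exp_add, neg_add_cancel, Real.exp_zero] at h4
      linarith
    calc _ ≤ ((n : ℝ) + 1) * (a / ((n : ℝ) + 1) * Real.exp (a / ((n : ℝ) + 1))) := by gcongr
      _ = _ := by field_simp

/-! ### The Laplace exponent of the process and the value ψ(Φ(q)) = q -/

lemma laplaceExponent_eq_log_mgf {Ω : Type*} [MeasurableSpace Ω] {P : Measure Ω} {X : ℝ≥0 → Ω → ℝ}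
    (c : ℝ) : laplaceExponent X P c = Real.log (mgf (X 1) P c) := rfl

section

variable {Ω : Type*} [MeasurableSpace Ω] {P : Measure Ω} [IsProbabilityMeasure P]
  {X : ℝ≥0 → Ω → ℝ}

lemma IsSpectrallyNegativeLevy.isSmallTimeApprox (hX : IsSpectrallyNegativeLevy X P)
    (hI : ∀ c, 0 ≤ c → Integrable (fun w => Real.exp (c * X 1 w)) P) :
    IsSmallTimeApprox P (gridIncrement X) (laplaceExponent X P) := by
  have hpos : ∀ c, 0 ≤ c → 0 < mgf (X 1) P c := fun c hc => mgf_pos (hI c hc)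
  -- `mgf` is 0 where the exponential is not integrable, and the power identity holds even then.
  -- Nonvanishing for X 1 thus passes to the increments and yields their integrability.
  have hpos' : ∀ (n : ℕ) (c : ℝ), 0 ≤ c → 0 < mgf (gridIncrement X n) P c := fun n c hc => by
    refine lt_of_le_of_ne mgf_nonneg fun h => ?_
    have := hX.mgf_gridIncrement_pow n c
    rw [← h, zero_pow (by lia)] at this
    exact (hpos c hc).ne this
  refine ⟨hX.measurable_gridIncrement, fun n c hc => ?_, fun c hc => ?_,
    fun ε hε => hX.tendsto_measure_gridIncrement hε⟩
  · by_contra hn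
    exact (hpos' n c hc).ne' (mgf_undef hn)
  · refine (tendsto_mul_exp_div_sub_one _).congr fun n => ?_
    rw [laplaceExponent_eq_log_mgf, ← hX.mgf_gridIncrement_pow n c, Real.log_pow]
    have : ((n + 1 : ℕ) : ℝ) * Real.log (mgf (gridIncrement X n) P c) / ((n : ℝ) + 1) =
        Real.log (mgf (gridIncrement X n) P c) := by
      push_cast; field_simp
    rw [this, Real.exp_log (hpos' n c hc)]

/-- Convexity of exp between 0 and X 1, followed by log x ≤ x - 1. This linear bound controls ψ from
above near 0, where 0 may be a boundary point of the domain of the moment generating function. -/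
lemma laplaceExponent_le_mul {Φ : ℝ}
    (hI : ∀ c, 0 ≤ c → Integrable (fun w => Real.exp (c * X 1 w)) P) (h0 : 0 ≤ Φ) (h1 : Φ ≤ 1) :
    laplaceExponent X P Φ ≤ Φ * (mgf (X 1) P 1 - 1) := by
  have h : mgf (X 1) P Φ ≤ 1 + Φ * (mgf (X 1) P 1 - 1) := by
    have i1 := hI 1 zero_le_one
    have hpt : ∀ w, Real.exp (Φ * X 1 w) ≤ (1 - Φ) + Φ * Real.exp (1 * X 1 w) := fun w => by
      have := convexOn_exp.2 (Set.mem_univ 0) (Set.mem_univ (X 1 w)) (sub_nonneg.2 h1) h0 (by ring)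
      simpa using this
    have := integral_mono (hI Φ h0) ((integrable_const (1 - Φ)).add (i1.const_mul Φ)) hpt
    rw [integral_add' (integrable_const _) (i1.const_mul Φ), integral_const_mul] at this
    simp only [integral_const, probReal_univ, smul_eq_mul, one_mul] at this
    simp only [mgf, one_mul]
    linarith
  rw [laplaceExponent_eq_log_mgf]
  have := Real.log_le_sub_one_of_pos (mgf_pos (hI Φ h0))
  linarith

/-- If Φ(q) > 0, then ψ is continuous there, at most q on the left by definition of the infimum and
above q on the right. If Φ(q) = 0, then q < ψ(c) for all c > 0, and the linear bound on ψ forces q ≤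
0 = ψ(0). -/
lemma laplaceExponent_exponentInverse {q : ℝ} (hq : 0 ≤ q)
    (hI : ∀ c, 0 ≤ c → Integrable (fun w => Real.exp (c * X 1 w)) P)
    (hgt : ∀ θ, exponentInverse (laplaceExponent X P) q < θ → q < laplaceExponent X P θ) :
    laplaceExponent X P (exponentInverse (laplaceExponent X P) q) = q := by
  set Φ := exponentInverse (laplaceExponent X P) q with hΦ
  rcases (exponentInverse_nonneg (laplaceExponent X P) q).eq_or_lt with h0 | h0
  · rw [← hΦ] at h0
    rw [← h0] at hgt ⊢
    have h1 : laplaceExponent X P 0 = 0 := by simp [laplaceExponent_eq_log_mgf]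
    rw [h1]
    refine le_antisymm hq ?_
    have ht : Tendsto (fun c : ℝ => c * (mgf (X 1) P 1 - 1)) (𝓝[>] 0) (𝓝 0) := by
      have : Continuous fun c : ℝ => c * (mgf (X 1) P 1 - 1) := by fun_prop
      simpa using (this.tendsto 0).mono_left nhdsWithin_le_nhds
    refine ge_of_tendsto ht ?_
    filter_upwards [Ioc_mem_nhdsGT (show (0 : ℝ) < 1 by norm_num)] with c hc
    exact (hgt c hc.1).le.trans (laplaceExponent_le_mul hI hc.1.le hc.2)
  · rw [← hΦ] at h0
    have hsub : Set.Ioi (0 : ℝ) ⊆ interior (integrableExpSet (X 1) P) :=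
      interior_maximal (fun c hc => hI c (le_of_lt hc)) isOpen_Ioi
    have hc : ContinuousAt (laplaceExponent X P) Φ := by
      have := (continuousOn_mgf (X := X 1) (μ := P)).continuousAt
        (mem_of_superset (Ioi_mem_nhds h0) hsub)
      exact ContinuousAt.log this (mgf_pos (hI Φ h0.le)).ne'
    refine le_antisymm ?_ ?_
    · refine le_of_tendsto (hc.tendsto.mono_left (nhdsWithin_le_nhds (s := Set.Iio Φ))) ?_
      filter_upwards [Ioo_mem_nhdsLT h0] with c hcm
      by_contra! hlt
      exact absurd (csInf_le (s := {c : ℝ | 0 ≤ c ∧ q < laplaceExponent X P c})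
        ⟨0, fun _ h => h.1⟩ ⟨hcm.1.le, hlt⟩) (not_le.2 hcm.2)
    · refine ge_of_tendsto (hc.tendsto.mono_left (nhdsWithin_le_nhds (s := Set.Ioi Φ))) ?_
      filter_upwards [self_mem_nhdsWithin] with c hcm
      exact (hgt c hcm).le

/-- The scale function tilted by `exp (-Φ(q) x)` is nondecreasing. -/
theorem IsScaleFunction.monotone_tilt (hX : IsSpectrallyNegativeLevy X P) {q : ℝ} (hq : 0 ≤ q)
    {W : ℝ → ℝ} (hW : IsScaleFunction (laplaceExponent X P) q W) :
    Monotone fun x => Real.exp (-exponentInverse (laplaceExponent X P) q * x) * W x := by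
  -- If ψ(θ) ≤ q for some θ beyond Φ(q), then W = 0 and nothing remains to prove.
  by_cases hgt : ∀ θ, exponentInverse (laplaceExponent X P) q < θ → q < laplaceExponent X P θ
  swap
  · push Not at hgt
    obtain ⟨θ, hθ, hle⟩ := hgt
    simp_rw [hW.eq_zero_of_le hθ hle, mul_zero]
    exact monotone_const
  have hΦ0 := exponentInverse_nonneg (laplaceExponent X P) q
  have hI : ∀ c, 0 ≤ c → Integrable (fun w => Real.exp (c * X 1 w)) P := by
    intro c hc
    -- Beyond Φ(q) one has ψ > q ≥ 0. Without integrability the exponent would be `Real.log 0 = 0`,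
    -- so e^{θ X 1} is integrable, and with it all smaller nonnegative exponents.
    set θ := exponentInverse (laplaceExponent X P) q + c + 1
    have hθ : Integrable (fun w => Real.exp (θ * X 1 w)) P := by
      by_contra hn
      have h1 := hgt θ (by linarith)
      rw [laplaceExponent_eq_log_mgf, mgf_undef hn, Real.log_zero] at h1
      linarith
    exact integrable_exp_mul_of_nonneg_of_le hθ hc (by linarith)
  have hψΦ := laplaceExponent_exponentInverse hq hI hgt
  have hA := hX.isSmallTimeApprox hI
  set ψ := laplaceExponent X P
  set Φ := exponentInverse ψ q
  set V : ℝ → ℝ := fun x => Real.exp (-Φ * x) * W x with hV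
  have hprod : ∀ θ x, Real.exp (-θ * x) * V x = Real.exp (-(Φ + θ) * x) * W x := fun θ x => by
    simp only [hV]
    rw [← mul_assoc, ← Real.exp_add]
    ring_nf
  have hcompl : ∀ θ, ∀ x ∉ Set.Ici (0 : ℝ), Real.exp (-(Φ + θ) * x) * W x = 0 := fun θ x hx => by
    rw [hW.zero_of_neg x (by simpa using hx), mul_zero]
  have hint : ∀ θ, 0 < θ → Integrable fun x => Real.exp (-θ * x) * V x := by
    intro θ hθ
    simp_rw [hprod]
    exact (integrableOn_iff_integrable_of_support_subset
      (Function.support_subset_iff'.2 (hcompl θ))).1 (hW.integrableOn _ (by linarith))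
  have hlapV : ∀ θ, 0 < θ → ∫ x, Real.exp (-θ * x) * V x = 1 / (ψ (Φ + θ) - ψ Φ) := by
    intro θ hθ
    simp_rw [hprod]
    rw [← setIntegral_eq_integral_of_forall_compl_eq_zero (hcompl θ),
      hW.laplace _ (by linarith), hψΦ]
  have happ : ∀ θ, 0 < θ → (∀ᶠ n in atTop,
      lapTransform (approxScaleMeasure P (gridIncrement X) Φ n) θ ≠ ⊤) ∧
      Tendsto (fun n => lapTransform (approxScaleMeasure P (gridIncrement X) Φ n) θ) atTop
        (𝓝 (ENNReal.ofReal (∫ x, Real.exp (-θ * x) * V x))) := by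
    intro θ hθ
    have ht := hA.tendsto_approx hΦ0 hθ.le
    have hpos : 0 < ψ (Φ + θ) - ψ Φ := by
      have := hgt (Φ + θ) (by linarith)
      linarith
    have hev := ht.eventually (lt_mem_nhds hpos)
    have he := hev.mono fun n hn => hA.lapTransform_approxScaleMeasure hΦ0 hθ n hn
    refine ⟨he.mono fun n hn => by rw [hn]; exact ENNReal.ofReal_ne_top, ?_⟩
    rw [hlapV θ hθ]
    refine Tendsto.congr' (he.mono fun n hn => hn.symm) ?_
    exact (ENNReal.continuous_ofReal.tendsto _).comp (tendsto_const_nhds.div ht hpos.ne')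
  -- The transform formula holds only for large n, so the first N measures are dropped to have
  -- finite transforms at 1 throughout.
  obtain ⟨N, hN⟩ := eventually_atTop.1 (happ 1 one_pos).1
  refine monotone_of_tendsto_lapTransform (V := V)
    (μ := fun n => approxScaleMeasure P (gridIncrement X) Φ (n + N))
    (Measurable.mul (by fun_prop) hW.measurable)
    (fun x => mul_nonneg (Real.exp_nonneg _) (hW.nonneg x))
    (fun x hx => by simp only [hV]; rw [hW.zero_of_neg x hx, mul_zero])
    (ContinuousOn.mul (by fun_prop) hW.continuousOn) ?_
    (fun n => approxScaleMeasure_Iio_zero _ _ _ _)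
    (fun n f hf h hh => lintegral_conv_restrict_Ioi_le_shift _ hf hh)
    (fun n => hN _ (by lia)) (fun k => ?_)
  · simpa using hint 1 one_pos
  · exact (happ (k + 1) (by positivity)).2.comp (tendsto_add_atTop_nat N)

end

/-! ### A Gronwall lemma on the left half-line -/

lemma tendsto_integral_indicator_Iic_atBot {k : ℝ → ℝ} (hk : Integrable k) :
    Tendsto (fun b => ∫ y, (Set.Iic b).indicator k y) atBot (𝓝 0) := by
  have := tendsto_integral_filter_of_dominated_convergence (μ := volume) (l := atBot)
    (F := fun b y => (Set.Iic b).indicator k y) (f := fun _ => 0) (fun y => ‖k y‖)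
    (Eventually.of_forall fun b => (hk.indicator measurableSet_Iic).aestronglyMeasurable)
    (Eventually.of_forall fun b => Eventually.of_forall fun y => norm_indicator_le_norm_self _ _)
    hk.norm (Eventually.of_forall fun y => ?_)
  · simpa using this
  · refine tendsto_const_nhds.congr' ?_
    filter_upwards [eventually_lt_atBot y] with b hb
    rw [Set.indicator_of_notMem (by simpa using hb)]

lemma tendsto_integral_indicator_Icc {k : ℝ → ℝ} (hk : Integrable k) (s : ℝ) :
    Tendsto (fun b => ∫ y, (Set.Icc s b).indicator k y) (𝓝[≥] s) (𝓝 0) := by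
  have := tendsto_integral_filter_of_dominated_convergence (μ := volume) (l := 𝓝[≥] s)
    (F := fun b y => (Set.Icc s b).indicator k y) (f := fun _ => 0) (fun y => ‖k y‖)
    (Eventually.of_forall fun b => (hk.indicator measurableSet_Icc).aestronglyMeasurable)
    (Eventually.of_forall fun b => Eventually.of_forall fun y => norm_indicator_le_norm_self _ _)
    hk.norm ?_
  · simpa using this
  · filter_upwards [Measure.ae_ne volume s] with y hy
    refine tendsto_const_nhds.congr' ?_
    rcases hy.lt_or_gt with h | h
    · refine Eventually.of_forall fun b => ?_
      exact (Set.indicator_of_notMem (fun hm => absurd hm.1 (not_le.2 h)) k).symm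
    · filter_upwards [nhdsWithin_le_nhds (Iio_mem_nhds h)] with b hb
      exact (Set.indicator_of_notMem (fun hm => absurd hm.2 (not_le.2 hb)) k).symm

/-- H can be nonzero only on T, where k has mass at most 1/2, so each use of the inequality halves
the upper bound: H ≤ C / 2^n for all n. -/
lemma eq_zero_on_Iic_of_integral_le_half {k H : ℝ → ℝ} (hk : Integrable k) (hk0 : ∀ y, 0 ≤ k y)
    {b C : ℝ} (hH0 : ∀ y, 0 ≤ H y) (hHC : ∀ y ≤ b, H y ≤ C)
    (hH : ∀ x ≤ b, H x ≤ ∫ y, (Set.Iic x).indicator (fun y => H y * k y) y)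
    {T : Set ℝ} (hTm : MeasurableSet T) (hT : ∀ y ≤ b, y ∉ T → H y = 0)
    (hTk : ∫ y, T.indicator k y ≤ 1 / 2) : ∀ x ≤ b, H x = 0 := by
  have hC : 0 ≤ C := (hH0 b).trans (hHC b le_rfl)
  have key : ∀ n : ℕ, ∀ x ≤ b, H x ≤ C * (1 / 2) ^ n := by
    intro n
    induction n with
    | zero => simpa using hHC
    | succ n ih =>
      intro x hx
      have hD : 0 ≤ C * (1 / 2) ^ n := by positivity
      have h1 : ∫ y, (Set.Iic x).indicator (fun y => H y * k y) y ≤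
          ∫ y, C * (1 / 2) ^ n * T.indicator k y := by
        refine integral_mono_of_nonneg (Eventually.of_forall fun y => ?_)
          ((hk.indicator hTm).const_mul _) (Eventually.of_forall fun y => ?_)
        · exact Set.indicator_nonneg (fun y _ => mul_nonneg (hH0 y) (hk0 y)) y
        · have hR : 0 ≤ C * (1 / 2) ^ n * T.indicator k y :=
            mul_nonneg hD (Set.indicator_nonneg (fun y _ => hk0 y) y)
          by_cases hy : y ≤ x
          · by_cases hyT : y ∈ T
            · simp only [Set.indicator_of_mem (show y ∈ Set.Iic x from hy),
                Set.indicator_of_mem hyT]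
              exact mul_le_mul_of_nonneg_right (ih y (hy.trans hx)) (hk0 y)
            · simp only [Set.indicator_of_mem (show y ∈ Set.Iic x from hy)]
              rw [hT y (hy.trans hx) hyT, zero_mul]
              exact hR
          · simp only [Set.indicator_of_notMem (show y ∉ Set.Iic x from hy)]
            exact hR
      rw [integral_const_mul] at h1
      calc H x ≤ _ := hH x hx
        _ ≤ C * (1 / 2) ^ n * ∫ y, T.indicator k y := h1
        _ ≤ C * (1 / 2) ^ n * (1 / 2) := by gcongr
        _ = C * (1 / 2) ^ (n + 1) := by ring
  intro x hx
  refine le_antisymm ?_ (hH0 x)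
  have ht : Tendsto (fun n : ℕ => C * (1 / 2 : ℝ) ^ n) atTop (𝓝 0) := by
    simpa using (tendsto_pow_atTop_nhds_zero_of_lt_one (r := (1 / 2 : ℝ)) (by norm_num)
      (by norm_num)).const_mul C
  exact ge_of_tendsto' ht fun n => key n x hx

/-- Continuation argument: the mass of k near -∞ is small, which gives a first half-line on which H
= 0. If s is the supremum of the right endpoints of such half-lines, the mass of k on [s, b] is
small for b slightly above s, so the half-line extends past s unless A has been reached. -/
lemma eq_zero_of_le_integral_Iic {k H : ℝ → ℝ} (hk : Integrable k) (hk0 : ∀ y, 0 ≤ k y)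
    {A C : ℝ} (hH0 : ∀ y, 0 ≤ H y) (hHC : ∀ y ≤ A, H y ≤ C)
    (hH : ∀ x ≤ A, H x ≤ ∫ y, (Set.Iic x).indicator (fun y => H y * k y) y) :
    ∀ x ≤ A, H x = 0 := by
  set S : Set ℝ := {b | b ≤ A ∧ ∀ y ≤ b, H y = 0} with hS
  have hstep : ∀ b ≤ A, ∀ T, MeasurableSet T → (∀ y ≤ b, y ∉ T → H y = 0) →
      ∫ y, T.indicator k y ≤ 1 / 2 → b ∈ S := fun b hb T hTm hT hTk =>
    ⟨hb, eq_zero_on_Iic_of_integral_le_half hk hk0 hH0 (fun y hy => hHC y (hy.trans hb))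
      (fun x hx => hH x (hx.trans hb)) hTm hT hTk⟩
  have hhalf : (0 : ℝ) < 1 / 2 := by norm_num
  have hne : S.Nonempty := by
    obtain ⟨b, hb1, hb2⟩ := (((tendsto_integral_indicator_Iic_atBot hk).eventually
      (gt_mem_nhds hhalf)).and (eventually_le_atBot A)).exists
    exact ⟨b, hstep b hb2 (Set.Iic b) measurableSet_Iic (fun y hy hn => absurd hy hn) hb1.le⟩
  have hbdd : BddAbove S := ⟨A, fun b hb => hb.1⟩
  set s := sSup S with hs
  have hsA : s ≤ A := csSup_le hne fun b hb => hb.1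
  have hlt : ∀ y < s, H y = 0 := fun y hy => by
    obtain ⟨b, hb, hyb⟩ := exists_lt_of_lt_csSup hne hy
    exact hb.2 y hyb.le
  obtain ⟨u, hu, hsub⟩ := mem_nhdsGE_iff_exists_Icc_subset.1
    ((tendsto_integral_indicator_Icc hk s).eventually (gt_mem_nhds hhalf))
  have hu' : s < u := hu
  have hmem : min A u ∈ S := by
    refine hstep _ (min_le_left _ _) (Set.Icc s (min A u)) measurableSet_Icc (fun y hy hn => ?_) ?_
    · refine hlt y ?_
      by_contra! hys
      exact hn ⟨hys, hy⟩
    · have : ∫ y, (Set.Icc s (min A u)).indicator k y < 1 / 2 :=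
        hsub ⟨le_min hsA hu'.le, min_le_right _ _⟩
      exact this.le
  have hle : min A u ≤ s := le_csSup hbdd hmem
  have hAs : A ≤ u := by
    by_contra! h
    rw [min_eq_right h.le] at hle
    linarith
  rw [min_eq_left hAs] at hmem
  exact hmem.2

/-! ### Convolution with a kernel whose exponential tilt is nondecreasing -/

/-- `G` is dominated by a multiple of `exp (Φ x)` on every left half-line. -/
def IsExpBddAtLeft (Φ : ℝ) (G : ℝ → ℝ) : Prop :=
  ∀ A : ℝ, ∃ C : ℝ, ∀ y ≤ A, |G y| ≤ C * Real.exp (Φ * y)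

/-- On [x₀, A] the local bound is absorbed into a multiple of e^{Φy}, since e^{Φy} ≥ e^{Φx₀} there
for Φ ≥ 0. -/
lemma HasSubexpLeftTailOf.isExpBddAtLeft {Φ : ℝ} (hΦ : 0 ≤ Φ) {G : ℝ → ℝ}
    (h : HasSubexpLeftTailOf Φ G) (hb : IsLocallyBddFun G) : IsExpBddAtLeft Φ G := by
  intro A
  obtain ⟨x₀, γ, hγ⟩ := h
  obtain ⟨C, hC⟩ := hb x₀ A
  refine ⟨|γ| + |C| * Real.exp (-(Φ * x₀)), fun y hy => ?_⟩
  rw [add_mul]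
  rcases le_or_gt y x₀ with h1 | h1
  · have : |G y| ≤ |γ| * Real.exp (Φ * y) :=
      (hγ y h1).trans (by gcongr; exact le_abs_self γ)
    have : 0 ≤ |C| * Real.exp (-(Φ * x₀)) * Real.exp (Φ * y) := by positivity
    linarith
  · have h2 : |G y| ≤ |C| := (hC y ⟨h1.le, hy⟩).trans (le_abs_self C)
    have h3 : 1 ≤ Real.exp (-(Φ * x₀)) * Real.exp (Φ * y) := by
      rw [← Real.exp_add]
      exact Real.one_le_exp (by nlinarith)
    have : |C| ≤ |C| * Real.exp (-(Φ * x₀)) * Real.exp (Φ * y) := by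
      rw [mul_assoc]
      exact le_mul_of_one_le_right (abs_nonneg _) h3
    have : 0 ≤ |γ| * Real.exp (Φ * y) := by positivity
    linarith

lemma realConv_apply (f g : ℝ → ℝ) (x : ℝ) : realConv f g x = ∫ y, f y * g (x - y) := rfl

lemma realConvFinite_iff (f g : ℝ → ℝ) :
    RealConvFinite f g ↔ ∀ x, Integrable fun y => f y * g (x - y) := Iff.rfl

lemma measurable_realConv {f g : ℝ → ℝ} (hf : Measurable f) (hg : Measurable g) :
    Measurable (realConv f g) := by
  have : Measurable (Function.uncurry fun x y : ℝ => f y * g (x - y)) := by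
    unfold Function.uncurry
    fun_prop
  exact this.stronglyMeasurable.integral_prod_right.measurable

/-- For y ≤ x the tail bound gives ω(y) e^{Φy} ≤ C e^{(Φ+α)y}, so the integrand is dominated by a
multiple of the Laplace integrand of W at Φ + α > Φ, reflected at x. -/
lemma IsScaleFunction.realConvFinite_exp {ψ : ℝ → ℝ} {q : ℝ} {W : ℝ → ℝ}
    (hW : IsScaleFunction ψ q W) {ω : ℝ → ℝ} (hωm : Measurable ω)
    (hω0 : ∀ x, 0 ≤ ω x) (hωb : IsLocallyBddFun ω) (hω : HasSubexpLeftTail ω) :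
    RealConvFinite (fun y => ω y * Real.exp (exponentInverse ψ q * y)) W := by
  rw [realConvFinite_iff]
  intro x
  obtain ⟨α, hα, htail⟩ := hω
  obtain ⟨C, hC⟩ := htail.isExpBddAtLeft hα.le hωb x
  set Φ := exponentInverse ψ q
  have hWm := hW.measurable
  have hi : Integrable fun z => Real.exp (-(Φ + α) * z) * W z :=
    (integrableOn_iff_integrable_of_support_subset (s := Set.Ici 0)
      (Function.support_subset_iff'.2 fun z hz => by
        rw [hW.zero_of_neg z (by simpa using hz), mul_zero])).1 (hW.integrableOn _ (by linarith))
  refine ((hi.comp_sub_left x).const_mul (C * Real.exp ((Φ + α) * x))).mono' (by fun_prop)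
    (Eventually.of_forall fun y => ?_)
  have hWy := hW.nonneg (x - y)
  rw [Real.norm_of_nonneg (mul_nonneg (mul_nonneg (hω0 y) (Real.exp_nonneg _)) hWy)]
  rcases le_or_gt y x with hy | hy
  · have h1 : ω y ≤ C * Real.exp (α * y) := (le_abs_self _).trans (hC y hy)
    calc ω y * Real.exp (Φ * y) * W (x - y)
        ≤ C * Real.exp (α * y) * Real.exp (Φ * y) * W (x - y) := by gcongr
      _ = C * (Real.exp ((Φ + α) * x) * Real.exp (-(Φ + α) * (x - y))) * W (x - y) := by
        rw [mul_assoc C, ← Real.exp_add, ← Real.exp_add]; ring_nf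
      _ = _ := by ring
  · rw [hW.zero_of_neg (x - y) (by linarith)]
    simp

section

variable {W ω : ℝ → ℝ} {Φ : ℝ}

lemma IsExpBddAtLeft.realConvFinite (hWm : Measurable W) (hW0 : ∀ x, 0 ≤ W x)
    (hWneg : ∀ x < 0, W x = 0) (hωm : Measurable ω) (hω0 : ∀ x, 0 ≤ ω x)
    (hfin : RealConvFinite (fun y => ω y * Real.exp (Φ * y)) W) {G : ℝ → ℝ} (hGm : Measurable G)
    (hG : IsExpBddAtLeft Φ G) : RealConvFinite (fun y => ω y * G y) W := by
  rw [realConvFinite_iff] at hfin ⊢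
  intro x
  obtain ⟨C, hC⟩ := hG x
  refine ((hfin x).const_mul C).mono' (by fun_prop) (Eventually.of_forall fun y => ?_)
  rw [Real.norm_eq_abs, abs_mul, abs_mul, abs_of_nonneg (hω0 y), abs_of_nonneg (hW0 _)]
  rcases le_or_gt y x with hy | hy
  · have h1 := hω0 y
    have h2 := hW0 (x - y)
    calc ω y * |G y| * W (x - y) ≤ ω y * (C * Real.exp (Φ * y)) * W (x - y) := by
          gcongr; exact hC y hy
      _ = _ := by ring
  · rw [hWneg (x - y) (by linarith)]
    simp

/-- The kernel `y ↦ ω(y) e^{-Φ (A - y)} W(A - y)`. -/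
noncomputable def tiltedKernel (Φ : ℝ) (ω W : ℝ → ℝ) (A y : ℝ) : ℝ :=
  ω y * (Real.exp (-Φ * (A - y)) * W (A - y))

lemma tiltedKernel_nonneg (hW0 : ∀ x, 0 ≤ W x) (hω0 : ∀ x, 0 ≤ ω x) (A y : ℝ) :
    0 ≤ tiltedKernel Φ ω W A y :=
  mul_nonneg (hω0 y) (mul_nonneg (Real.exp_nonneg _) (hW0 _))

lemma integrable_tiltedKernel (hfin : RealConvFinite (fun y => ω y * Real.exp (Φ * y)) W) (A : ℝ) :
    Integrable (tiltedKernel Φ ω W A) := by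
  refine ((realConvFinite_iff _ _).1 hfin A |>.const_mul (Real.exp (-Φ * A))).congr
    (Eventually.of_forall fun y => ?_)
  have : Real.exp (-Φ * (A - y)) = Real.exp (-Φ * A) * Real.exp (Φ * y) := by
    rw [← Real.exp_add]; ring_nf
  simp only [tiltedKernel, this]
  ring

/-- Splitting e^{-Φx} = e^{-Φy} e^{-Φ(x - y)} produces V(x - y), and monotonicity of V replaces it
by V(A - y). The kernel no longer depends on x, which the Gronwall lemma requires. -/
lemma exp_mul_abs_realConv_le (hW0 : ∀ x, 0 ≤ W x)
    (hWneg : ∀ x < 0, W x = 0) (hV : Monotone fun x => Real.exp (-Φ * x) * W x)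
    (hω0 : ∀ x, 0 ≤ ω x)
    (hfin : RealConvFinite (fun y => ω y * Real.exp (Φ * y)) W) {G : ℝ → ℝ} (hGm : Measurable G)
    (hG : IsExpBddAtLeft Φ G) {x A : ℝ} (hx : x ≤ A) :
    Real.exp (-Φ * x) * |realConv (fun y => ω y * G y) W x| ≤
      ∫ y, (Set.Iic x).indicator
        (fun y => Real.exp (-Φ * y) * |G y| * tiltedKernel Φ ω W A y) y := by
  obtain ⟨C, hC⟩ := hG x
  have hexp : ∀ y, Real.exp (-Φ * y) * (C * Real.exp (Φ * y)) = C := fun y => by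
    rw [mul_left_comm, ← Real.exp_add]
    simp
  have hker := integrable_tiltedKernel hfin A
  have hi : Integrable ((Set.Iic x).indicator
      (fun y => Real.exp (-Φ * y) * |G y| * tiltedKernel Φ ω W A y)) := by
    refine (hker.const_mul C).mono' ?_ (Eventually.of_forall fun y => ?_)
    · refine AEStronglyMeasurable.indicator ?_ measurableSet_Iic
      have : Measurable fun y => Real.exp (-Φ * y) * |G y| := by fun_prop
      exact this.aestronglyMeasurable.mul hker.aestronglyMeasurable
    · have hk0 := tiltedKernel_nonneg (Φ := Φ) hW0 hω0 A y
      by_cases hy : y ≤ x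
      · rw [Set.indicator_of_mem (show y ∈ Set.Iic x from hy),
          Real.norm_of_nonneg (by positivity)]
        gcongr
        calc _ ≤ Real.exp (-Φ * y) * (C * Real.exp (Φ * y)) := by gcongr; exact hC y hy
          _ = C := hexp y
      · rw [Set.indicator_of_notMem (show y ∉ Set.Iic x from hy), norm_zero]
        have hC0 : 0 ≤ C := by
          have h1 := (abs_nonneg _).trans (hC x le_rfl)
          exact nonneg_of_mul_nonneg_left h1 (Real.exp_pos _)
        positivity
  rw [realConv_apply, ← abs_of_pos (Real.exp_pos (-Φ * x)), ← abs_mul, ← integral_const_mul]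
  refine norm_integral_le_of_norm_le (f := fun y => Real.exp (-Φ * x) * (ω y * G y * W (x - y))) hi
    (Eventually.of_forall fun y => ?_)
  rw [Real.norm_eq_abs, abs_mul, abs_mul, abs_mul,
    abs_of_pos (Real.exp_pos _), abs_of_nonneg (hω0 y), abs_of_nonneg (hW0 _)]
  by_cases hy : y ≤ x
  · rw [Set.indicator_of_mem (show y ∈ Set.Iic x from hy)]
    have h1 : Real.exp (-Φ * (x - y)) * W (x - y) ≤ Real.exp (-Φ * (A - y)) * W (A - y) :=
      hV (by linarith)
    have h2 : Real.exp (-Φ * x) = Real.exp (-Φ * y) * Real.exp (-Φ * (x - y)) := by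
      rw [← Real.exp_add]; ring_nf
    have h3 := hω0 y
    calc Real.exp (-Φ * x) * (ω y * |G y| * W (x - y))
        = Real.exp (-Φ * y) * |G y| * (ω y * (Real.exp (-Φ * (x - y)) * W (x - y))) := by
          rw [h2]; ring
      _ ≤ Real.exp (-Φ * y) * |G y| * (ω y * (Real.exp (-Φ * (A - y)) * W (A - y))) := by
          gcongr
  · rw [Set.indicator_of_notMem (show y ∉ Set.Iic x from hy), hWneg (x - y) (by linarith)]
    simp

lemma tendsto_exp_mul_realConv_atBot (hW0 : ∀ x, 0 ≤ W x)
    (hWneg : ∀ x < 0, W x = 0) (hV : Monotone fun x => Real.exp (-Φ * x) * W x)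
    (hω0 : ∀ x, 0 ≤ ω x)
    (hfin : RealConvFinite (fun y => ω y * Real.exp (Φ * y)) W) {G : ℝ → ℝ} (hGm : Measurable G)
    (hG : IsExpBddAtLeft Φ G) :
    Tendsto (fun x => Real.exp (-Φ * x) * realConv (fun y => ω y * G y) W x) atBot (𝓝 0) := by
  obtain ⟨C, hC⟩ := hG 0
  have hker := integrable_tiltedKernel hfin 0
  have hlim := (tendsto_integral_indicator_Iic_atBot hker).const_mul C
  rw [mul_zero] at hlim
  refine squeeze_zero_norm' ?_ hlim
  filter_upwards [eventually_le_atBot 0] with x hx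
  rw [norm_mul, Real.norm_of_nonneg (Real.exp_nonneg _), Real.norm_eq_abs]
  refine (exp_mul_abs_realConv_le hW0 hWneg hV hω0 hfin hGm hG hx).trans ?_
  rw [← integral_const_mul]
  refine integral_mono_of_nonneg (Eventually.of_forall fun y => ?_)
    ((hker.indicator measurableSet_Iic).const_mul C) (Eventually.of_forall fun y => ?_)
  · exact Set.indicator_nonneg (fun y _ => mul_nonneg (by positivity)
      (tiltedKernel_nonneg hW0 hω0 _ _)) y
  · by_cases hy : y ≤ x
    · simp only [Set.indicator_of_mem (show y ∈ Set.Iic x from hy)]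
      refine mul_le_mul_of_nonneg_right ?_ (tiltedKernel_nonneg hW0 hω0 _ _)
      calc _ ≤ Real.exp (-Φ * y) * (C * Real.exp (Φ * y)) := by
            gcongr; exact hC y (hy.trans hx)
        _ = C := by rw [mul_left_comm, ← Real.exp_add]; simp
    · simp [Set.indicator_of_notMem (show y ∉ Set.Iic x from hy)]

lemma eq_zero_of_eq_realConv (hW0 : ∀ x, 0 ≤ W x)
    (hWneg : ∀ x < 0, W x = 0) (hV : Monotone fun x => Real.exp (-Φ * x) * W x)
    (hω0 : ∀ x, 0 ≤ ω x)
    (hfin : RealConvFinite (fun y => ω y * Real.exp (Φ * y)) W) {G : ℝ → ℝ} (hGm : Measurable G)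
    (hG : IsExpBddAtLeft Φ G) (heq : ∀ x, G x = realConv (fun y => ω y * G y) W x) (x : ℝ) :
    G x = 0 := by
  obtain ⟨C, hC⟩ := hG x
  have h := eq_zero_of_le_integral_Iic (k := tiltedKernel Φ ω W x) (A := x) (C := C)
    (H := fun y => Real.exp (-Φ * y) * |G y|) (integrable_tiltedKernel hfin x)
    (tiltedKernel_nonneg hW0 hω0 x) (fun y => by positivity) (fun y hy => ?_) (fun y hy => ?_)
    x le_rfl
  · simpa using h
  · calc _ ≤ Real.exp (-Φ * y) * (C * Real.exp (Φ * y)) := by gcongr; exact hC y hy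
      _ = C := by rw [mul_left_comm, ← Real.exp_add]; simp
  · conv_lhs => rw [heq y]
    exact exp_mul_abs_realConv_le hW0 hWneg hV hω0 hfin hGm hG hy

/-! ### Picard iteration -/

lemma IsExpBddAtLeft.mono {G F : ℝ → ℝ} (hG : IsExpBddAtLeft Φ G) (h : ∀ x, |F x| ≤ |G x|) :
    IsExpBddAtLeft Φ F := fun A => by
  obtain ⟨C, hC⟩ := hG A
  exact ⟨C, fun y hy => (h y).trans (hC y hy)⟩

lemma realConv_mono (hW0 : ∀ x, 0 ≤ W x) (hω0 : ∀ x, 0 ≤ ω x)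
    {F G : ℝ → ℝ} (hF : RealConvFinite (fun y => ω y * F y) W)
    (hG : RealConvFinite (fun y => ω y * G y) W) (h : ∀ x, F x ≤ G x) (x : ℝ) :
    realConv (fun y => ω y * F y) W x ≤ realConv (fun y => ω y * G y) W x :=
  integral_mono (hF x) (hG x) fun y =>
    mul_le_mul_of_nonneg_right (mul_le_mul_of_nonneg_left (h y) (hω0 y)) (hW0 _)

lemma realConv_nonneg (hW0 : ∀ x, 0 ≤ W x) (hω0 : ∀ x, 0 ≤ ω x)
    {F : ℝ → ℝ} (h : ∀ x, 0 ≤ F x) (x : ℝ) : 0 ≤ realConv (fun y => ω y * F y) W x :=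
  integral_nonneg fun y => mul_nonneg (mul_nonneg (hω0 y) (h y)) (hW0 _)

lemma picardIterate_succ (g : ℝ → ℝ) (n : ℕ) (x : ℝ) : picardIterate ω W g (n + 1) x =
    g x + realConv (fun y => ω y * picardIterate ω W g n y) W x := rfl

lemma measurable_picardIterate (hWm : Measurable W) (hωm : Measurable ω) {g : ℝ → ℝ}
    (hg : Measurable g) (n : ℕ) : Measurable (picardIterate ω W g n) := by
  induction n with
  | zero => exact hg
  | succ n ih => exact hg.add (measurable_realConv (hωm.mul ih) hWm)

lemma picardIterate_nonneg (hW0 : ∀ x, 0 ≤ W x) (hω0 : ∀ x, 0 ≤ ω x) {g : ℝ → ℝ}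
    (hg : ∀ x, 0 ≤ g x) (n : ℕ) (x : ℝ) : 0 ≤ picardIterate ω W g n x := by
  induction n generalizing x with
  | zero => exact hg x
  | succ n ih => exact add_nonneg (hg x) (realConv_nonneg hW0 hω0 ih x)

/-- By induction the iterates increase and stay below G, which dominates every convolution. Their
limit L solves the same equation by dominated convergence; G - L is then a solution of the
homogeneous equation, bounded by G, and vanishes by `eq_zero_of_eq_realConv`. -/
lemma tendsto_picardIterate (hWm : Measurable W) (hW0 : ∀ x, 0 ≤ W x)
    (hWneg : ∀ x < 0, W x = 0) (hV : Monotone fun x => Real.exp (-Φ * x) * W x)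
    (hωm : Measurable ω) (hω0 : ∀ x, 0 ≤ ω x)
    (hfin : RealConvFinite (fun y => ω y * Real.exp (Φ * y)) W) {G : ℝ → ℝ} (hGm : Measurable G)
    (hG : IsExpBddAtLeft Φ G) {g : ℝ → ℝ} (hgm : Measurable g) (hg0 : ∀ x, 0 ≤ g x)
    (hG0 : ∀ x, 0 ≤ G x) (heq : ∀ x, G x = g x + realConv (fun y => ω y * G y) W x) :
    (∀ n, RealConvFinite (fun y => ω y * picardIterate ω W g n y) W) ∧
      ∀ x, Monotone (fun n => picardIterate ω W g n x) ∧
        Tendsto (fun n => picardIterate ω W g n x) atTop (𝓝 (G x)) := by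
  have hconvG := hG.realConvFinite hWm hW0 hWneg hωm hω0 hfin hGm
  have hmeas := measurable_picardIterate (ω := ω) (W := W) hWm hωm hgm
  have hnn := picardIterate_nonneg (ω := ω) (W := W) hW0 hω0 hg0
  have hconv_of_le : ∀ F : ℝ → ℝ, Measurable F → (∀ x, 0 ≤ F x) → (∀ x, F x ≤ G x) →
      RealConvFinite (fun y => ω y * F y) W := fun F hF h0 hle =>
    (hG.mono fun x => abs_le_abs_of_nonneg (h0 x) (hle x)).realConvFinite hWm hW0 hWneg hωm hω0
      hfin hF
  have hle : ∀ n x, picardIterate ω W g n x ≤ G x := by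
    intro n
    induction n with
    | zero =>
      intro x
      rw [heq x]
      exact le_add_of_nonneg_right (realConv_nonneg hW0 hω0 hG0 x)
    | succ n ih =>
      intro x
      rw [heq x, picardIterate_succ]
      exact add_le_add_right (realConv_mono hW0 hω0
        (hconv_of_le _ (hmeas n) (hnn n) ih) hconvG ih x) _
  have hconv : ∀ n, RealConvFinite (fun y => ω y * picardIterate ω W g n y) W := fun n =>
    hconv_of_le _ (hmeas n) (hnn n) (hle n)
  have hstep : ∀ n x, picardIterate ω W g n x ≤ picardIterate ω W g (n + 1) x := by
    intro n
    induction n with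
    | zero => exact fun x => le_add_of_nonneg_right (realConv_nonneg hW0 hω0 hg0 x)
    | succ n ih =>
      exact fun x => add_le_add_right (realConv_mono hW0 hω0 (hconv n) (hconv (n + 1)) ih x) _
  have hmono : ∀ x, Monotone (fun n => picardIterate ω W g n x) := fun x =>
    monotone_nat_of_le_succ fun n => hstep n x
  refine ⟨hconv, fun x => ⟨hmono x, ?_⟩⟩
  have hlim : ∀ x, Tendsto (fun n => picardIterate ω W g n x) atTop
      (𝓝 (⨆ n, picardIterate ω W g n x)) := fun x =>
    tendsto_atTop_ciSup (hmono x) ⟨G x, by rintro _ ⟨n, rfl⟩; exact hle n x⟩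
  set L : ℝ → ℝ := fun x => ⨆ n, picardIterate ω W g n x with hL
  have hLm : Measurable L := measurable_of_tendsto_metrizable hmeas (tendsto_pi_nhds.2 hlim)
  have hL0 : ∀ x, 0 ≤ L x := fun x => ge_of_tendsto' (hlim x) fun n => hnn n x
  have hLG : ∀ x, L x ≤ G x := fun x => le_of_tendsto' (hlim x) fun n => hle n x
  have hconvL := hconv_of_le L hLm hL0 hLG
  have hLeq : ∀ x, L x = g x + realConv (fun y => ω y * L y) W x := by
    intro x
    refine tendsto_nhds_unique ((tendsto_add_atTop_iff_nat 1).2 (hlim x)) ?_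
    simp_rw [picardIterate_succ]
    refine tendsto_const_nhds.add ?_
    refine tendsto_integral_of_dominated_convergence (fun y => ω y * G y * W (x - y))
      (fun n => (hconv n x).aestronglyMeasurable) (hconvG x)
      (fun n => Eventually.of_forall fun y => ?_) (Eventually.of_forall fun y => ?_)
    · have h1 : 0 ≤ ω y * picardIterate ω W g n y * W (x - y) :=
        mul_nonneg (mul_nonneg (hω0 y) (hnn n y)) (hW0 _)
      refine (Real.norm_of_nonneg h1).trans_le ?_
      exact mul_le_mul_of_nonneg_right (mul_le_mul_of_nonneg_left (hle n y) (hω0 y)) (hW0 _)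
    · exact ((hlim y).const_mul (ω y)).mul_const (W (x - y))
  have hdiff : ∀ x, (G x - L x) = realConv (fun y => ω y * (G y - L y)) W x := by
    intro x
    have e : realConv (fun y => ω y * (G y - L y)) W x =
        realConv (fun y => ω y * G y) W x - realConv (fun y => ω y * L y) W x := by
      simp only [realConv_apply]
      have h1 : Integrable fun y => ω y * G y * W (x - y) := hconvG x
      have h2 : Integrable fun y => ω y * L y * W (x - y) := hconvL x
      rw [← integral_sub h1 h2]
      exact integral_congr_ae (Eventually.of_forall fun y => by ring)
    rw [e, heq x, hLeq x]
    ring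
  have hbd : IsExpBddAtLeft Φ fun x => G x - L x := hG.mono fun x =>
    abs_le_abs_of_nonneg (by linarith [hLG x]) (by linarith [hL0 x])
  have hz := eq_zero_of_eq_realConv hW0 hWneg hV hω0 hfin (hGm.sub hLm) hbd hdiff x
  have : G x = L x := by
    have hz' : G x - L x = 0 := hz
    linarith
  rw [this]
  exact hlim x

end

theorem lemma2 {Ω : Type*} [MeasurableSpace Ω] (P : Measure Ω) [IsProbabilityMeasure P]
    (X : ℝ≥0 → Ω → ℝ) (hX : IsSpectrallyNegativeLevy X P)
    (q : ℝ) (hq : 0 ≤ q)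
    (W : ℝ → ℝ) (hW : IsScaleFunction (laplaceExponent X P) q W)
    (Φq : ℝ) (hΦq : Φq = exponentInverse (laplaceExponent X P) q)
    (ω : ℝ → ℝ) (hω_meas : Measurable ω) (hω_nonneg : ∀ x, 0 ≤ ω x)
    (hω_bdd : IsLocallyBddFun ω) :
    (HasSubexpLeftTail ω → RealConvFinite (fun y => ω y * Real.exp (Φq * y)) W) ∧
    (RealConvFinite (fun y => ω y * Real.exp (Φq * y)) W →
      ∀ G : ℝ → ℝ, Measurable G → IsLocallyBddFun G → HasSubexpLeftTailOf Φq G →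
        (RealConvFinite (fun y => ω y * G y) W ∧
          Tendsto (fun x => Real.exp (-Φq * x) * realConv (fun y => ω y * G y) W x)
            atBot (𝓝 0)) ∧
        ((∀ x, G x = realConv (fun y => G y * ω y) W x) → ∀ x, G x = 0) ∧
        (∀ g : ℝ → ℝ, Measurable g → IsLocallyBddFun g → HasSubexpLeftTailOf Φq g →
          (∀ x, 0 ≤ g x) → (∀ x, 0 ≤ G x) →
          (∀ x, G x = g x + realConv (fun y => ω y * G y) W x) →
          (∀ n, RealConvFinite (fun y => ω y * picardIterate ω W g n y) W) ∧
          ∀ x, Monotone (fun n => picardIterate ω W g n x) ∧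
            Tendsto (fun n => picardIterate ω W g n x) atTop (𝓝 (G x)))) := by
  have hΦ0 : 0 ≤ Φq := hΦq ▸ exponentInverse_nonneg _ _
  have hV := IsScaleFunction.monotone_tilt hX hq hW
  rw [← hΦq] at hV
  have hWm := hW.measurable
  refine ⟨fun hω => ?_, fun hfin G hGm hGb hGt => ?_⟩
  · rw [hΦq]
    exact hW.realConvFinite_exp hω_meas hω_nonneg hω_bdd hω
  have hG := hGt.isExpBddAtLeft hΦ0 hGb
  refine ⟨⟨hG.realConvFinite hWm hW.nonneg hW.zero_of_neg hω_meas hω_nonneg hfin hGm,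
    tendsto_exp_mul_realConv_atBot hW.nonneg hW.zero_of_neg hV hω_nonneg hfin hGm hG⟩,
    fun heq => ?_, fun g hgm _ _ hg0 hG0 heq => ?_⟩
  · simp_rw [mul_comm (G _)] at heq
    exact eq_zero_of_eq_realConv hW.nonneg hW.zero_of_neg hV hω_nonneg hfin hGm hG heq
  · exact tendsto_picardIterate hWm hW.nonneg hW.zero_of_neg hV hω_meas hω_nonneg hfin hGm hG hgm
      hg0 hG0 heq
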